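/- Let $K$ be a field and let $\mathcal O\subseteq K$ be either the unit interval $[-1,1]$ of a total (field) order on $K$ or the ring of a non-trivial valuation of $K$. For $x,y\in K$ write $|y|\le|x|$ if $y\in x\mathcal O$, and $|y|<|x|$ if moreover $|x|\not\le|y|$; $|K^\times|$ denotes the ordered group $K^\times/\mathcal O^\times$. Endow $K$ with the topology generated by the open balls $\{x : |x-c|<|r|\}$ ($c\in K$, $r\in K^\times$) and $K^m$ with the product topology. Let $\mathcal L$ be a language extending the language of rings by at least a unary predicate symbol $\mathcal O$, and let $\mathcal K$ be an expansion of $(K,\mathcal O)$ to an $\mathcal L$-structure. "Definable" means first-order definable with parameters. * $\mathcal K$ satisfies (BFin) if every definable subset of $K$ that is closed, bounded and discrete is finite. * For a definable set $X\subseteq K^m$, $\mathcal C(X)$ is the ring of continuous definable functions $X\to K$, and $\mathcal B=\{s\in\mathcal C(X) : s(x)\in\mathcal O\text{ for all }x\in X\}$. The pair $(\mathcal C(X),\mathcal B)$ is a structure in the language $\mathcal L_{\rm ring}\cup\{\mathcal B\}$ of rings with one additional unary predicate. * Let $p_0\in X$ and let $U$ be a definable neighborhood of $p_0$ in $X$.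 Functions $s_1,\dots,s_k\in\mathcal C(U)$ vanish on separated germs at $p_0$ if each $s_i$ has a non-isolated zero at $p_0$, the sets $S_i=\{s_i=0\}\setminus\{p_0\}$ are pairwise disjoint, and there are bounded $\delta_1,\dots,\delta_k\in\mathcal C(U\setminus\{p_0\})$ such that, for $i\ne j$, $\delta_i$ is constantly $1$ on $S_i$ and constantly $0$ on $S_j$. The set $X$ has arbitrarily many germs at $p_0$ if for every positive integer $k$ there are a definable neighborhood $U$ of $p_0$ in $X$ and $k$ functions in $\mathcal C(U)$ that vanish on separated germs at $p_0$. * For $\tau\in K$, $|K^\times|$ is $\tau$-archimedean if for every $x\in K^\times$ there is $k\in\mathbb Z$ with $|\tau^k|\le|x|$. **Corollary 5.6.** Let $\mathcal K'=(K',\mathcal O',\dots)$ be an elementary extension of $\mathcal K$, and assume that $\mathcal K$ and $\mathcal K'$ both satisfy (BFin). Let $X\subseteq K^m$ be a definable set that has arbitrarily many germs at a point $p_0$, and let $X'\subseteq K'^m$ be defined by a formula (with parameters from $K$) defining $X$. Let $\mathcal C(X')$ and $\mathcal B'$ be formed in $\mathcal K'$. There is a unique map $\mathcal C(X)\to\mathcal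 C(X')$ that sends each $f$ to the function whose graph is defined in $\mathcal K'$ by the formulas (with parameters from $K$) that define the graph of $f$ in $\mathcal K$; this map is an $\mathcal L_{\rm ring}\cup\{\mathcal B\}$-embedding of $(\mathcal C(X),\mathcal B)$ into $(\mathcal C(X'),\mathcal B')$. If $|K^\times|$ is $\tau$-archimedean for some $\tau\in K$ and $|K'^\times|$ is not $\tau$-archimedean, then this natural embedding is not an elementary embedding. -/

import Mathlib

open FirstOrder Topology

universe u v w w'

namespace DefCont

open FirstOrder.Language Set

/-! ### The language of rings with one additional unary predicate -/

/-- The only relation symbol: a unary predicate. It is interpreted by `𝒪` in fields and by `ℬ` in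
rings of definable continuous functions. -/
inductive BallRel : ℕ → Type
  | ball : BallRel 1

/-- The language of rings together with one unary predicate symbol. -/
def ringBall : FirstOrder.Language.{0, 0} := ⟨ringFunc, BallRel⟩

/-- The interpretation of the ring symbols in a commutative ring. -/
def ringOp {R : Type*} [CommRing R] : ∀ {n : ℕ}, ringFunc n → (Fin n → R) → R
  | _, .add, x => x 0 + x 1
  | _, .mul, x => x 0 * x 1
  | _, .neg, x => - x 0
  | _, .zero, _ => 0
  | _, .one, _ => 1

/-- A commutative ring `R` with a subset `B`, as a structure in the language `ringBall`. -/
@[reducible] def ringBallStructure (R : Type*) [CommRing R] (B : Set R) : ringBall.Structure R where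
  funMap := fun f x => ringOp (R := R) f x
  RelMap := fun r x => match r, x with
    | .ball, x => x 0 ∈ B

/-! ### Ordered and valued fields, absolute values and the topology -/

/-- `O` is the unit interval `[-1, 1]` of a total (field) order of `K`, or the ring of a
non-trivial valuation of `K`. -/
def IsUnitBall {K : Type w} [Field K] (O : Set K) : Prop :=
  (∃ (_ : LinearOrder K) (_ : IsStrictOrderedRing K), O = Set.Icc (-1) 1) ∨
  (∃ A : ValuationSubring K, A ≠ ⊤ ∧ O = (A : Set K))

/-- `|y| ≤ |x|`, that is `y ∈ x·O`. -/
def AbsLE {K : Type w} [Field K] (O : Set K) (y x : K) : Prop := ∃ a ∈ O, y = x * a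

/-- `|y| < |x|`. -/
def AbsLT {K : Type w} [Field K] (O : Set K) (y x : K) : Prop := AbsLE O y x ∧ ¬ AbsLE O x y

/-- The open ball with center `c` and radius `r` in `K`. -/
def openBall {K : Type w} [Field K] (O : Set K) (c r : K) : Set K := {x | AbsLT O (x - c) r}

/-- The topology on `K` generated by the open balls with non-zero radius. The space `K^m` carries
the corresponding product topology, which is the topology generated by the balls of `K^m` for
`‖x‖ = max |x_i|`. -/
@[reducible] def ballTopology {K : Type w} [Field K] (O : Set K) : TopologicalSpace K :=
  TopologicalSpace.generateFrom {B | ∃ c r : K, r ≠ 0 ∧ B = openBall O c r}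

/-- A set of elements of `K` is bounded. -/
def IsBddSet {K : Type w} [Field K] (O : Set K) (S : Set K) : Prop := ∃ r : K, ∀ x ∈ S, AbsLE O x r

/-- `|K^×|` is `τ`-archimedean: `τ^ℤ` is coinitial in `|K^×|`. -/
def TauArchimedean {K : Type w} [Field K] (O : Set K) (τ : K) : Prop :=
  ∀ x : K, x ≠ 0 → ∃ k : ℤ, AbsLE O (τ ^ k) x

section Topology

variable {K : Type w} [Field K]

theorem isOpen_ballTopology {O : Set K} {s : Set K}
    (hs : ∀ x ∈ s, ∃ r, r ≠ 0 ∧ x ∈ openBall O x r ∧ openBall O x r ⊆ s) :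
    IsOpen[ballTopology O] s := by
  let _ := ballTopology O
  rw [isOpen_iff_forall_mem_open]
  intro x hx
  obtain ⟨r, hr, hxr, h⟩ := hs x hx
  exact ⟨_, h, TopologicalSpace.isOpen_generateFrom_of_mem ⟨x, r, hr, rfl⟩, hxr⟩

theorem absLE_Icc [LinearOrder K] [IsStrictOrderedRing K] (y x : K) :
    AbsLE (Set.Icc (-1 : K) 1) y x ↔ |y| ≤ |x| := by
  constructor
  · rintro ⟨a, ha, rfl⟩
    rw [abs_mul]
    exact mul_le_of_le_one_right (abs_nonneg _) (abs_le.2 ha)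
  · intro h
    by_cases hx : x = 0
    · subst hx
      refine ⟨0, ⟨by simp, by simp⟩, ?_⟩
      simpa using h
    · refine ⟨y / x, abs_le.1 ?_, by field_simp⟩
      rw [abs_div]
      exact div_le_one_of_le₀ h (abs_nonneg _)

theorem absLE_valuationSubring (A : ValuationSubring K) (y x : K) :
    AbsLE (A : Set K) y x ↔ A.valuation y ≤ A.valuation x := by
  constructor
  · rintro ⟨a, ha, rfl⟩
    rw [map_mul]
    exact mul_le_of_le_one_right' ((A.valuation_le_one_iff a).2 ha)
  · intro h
    by_cases hx : x = 0
    · subst hx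
      refine ⟨0, A.zero_mem, ?_⟩
      simpa using h
    · refine ⟨y / x, (A.valuation_le_one_iff _).1 ?_, by field_simp⟩
      rw [map_div₀]
      exact div_le_one_of_le₀ h zero_le

theorem ballTopology_Icc [LinearOrder K] [IsStrictOrderedRing K] :
    ballTopology (Set.Icc (-1 : K) 1) = Preorder.topology K := by
  have hb : ∀ c r : K, openBall (Set.Icc (-1 : K) 1) c r = {x | |x - c| < |r|} := by
    intro c r
    ext x
    simp only [openBall, AbsLT, absLE_Icc, mem_ofPred_eq, not_le]
    exact ⟨fun h => h.2, fun h => ⟨h.le, h⟩⟩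
  have hself : ∀ x r : K, r ≠ 0 → x ∈ openBall (Set.Icc (-1 : K) 1) x r := by
    intro x r hr
    simpa [hb] using hr
  apply le_antisymm
  · apply le_generateFrom
    rintro s ⟨a, rfl | rfl⟩
    · refine isOpen_ballTopology fun x hx => ⟨x - a, sub_ne_zero.2 (ne_of_gt hx), hself _ _ (sub_ne_zero.2 (ne_of_gt hx)), fun y hy => ?_⟩
      have hx' : 0 < x - a := sub_pos.2 hx
      rw [hb, mem_ofPred_eq, abs_of_pos hx'] at hy
      have := (abs_lt.1 hy).1
      simp only [mem_Ioi]
      linarith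
    · refine isOpen_ballTopology fun x hx => ⟨a - x, sub_ne_zero.2 (ne_of_gt hx), hself _ _ (sub_ne_zero.2 (ne_of_gt hx)), fun y hy => ?_⟩
      have hx' : 0 < a - x := sub_pos.2 hx
      rw [hb, mem_ofPred_eq, abs_of_pos hx'] at hy
      have := (abs_lt.1 hy).2
      simp only [mem_Iio]
      linarith
  · apply le_generateFrom
    rintro _ ⟨c, r, -, rfl⟩
    let _ : TopologicalSpace K := Preorder.topology K
    have _ : OrderTopology K := ⟨rfl⟩
    rw [hb]
    exact isOpen_lt (by fun_prop) continuous_const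

theorem ballTopology_valuationSubring (A : ValuationSubring K) :
    ballTopology (A : Set K) = (Valued.mk' A.valuation).toTopologicalSpace := by
  let vK := Valued.mk' A.valuation
  have hv : vK.v = A.valuation := rfl
  have hb : ∀ c r : K, openBall (A : Set K) c r =
      {x | A.valuation (x - c) < A.valuation r} := by
    intro c r
    ext x
    simp only [openBall, AbsLT, absLE_valuationSubring, mem_ofPred_eq, not_le]
    exact ⟨fun h => h.2, fun h => ⟨h.le, h⟩⟩
  apply le_antisymm
  · intro s hs
    refine isOpen_ballTopology fun x hx => ?_
    obtain ⟨γ, hγ⟩ := Valued.mem_nhds.1 (IsOpen.mem_nhds hs hx)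
    obtain ⟨a, b, ha, hb', hab⟩ := Valuation.exists_div_eq_of_unit vK.v γ
    have ha0 : a ≠ 0 := by rintro rfl; simp at ha
    have hb0 : b ≠ 0 := by rintro rfl; simp at hb'
    refine ⟨a / b, div_ne_zero ha0 hb0, ?_, fun y hy => hγ ?_⟩
    · rw [hb]
      simpa [zero_lt_iff] using ⟨ha0, hb0⟩
    · rw [hb] at hy
      rw [mem_ofPred_eq, ← hab, ← map_div₀]
      exact (Valuation.restrict_lt_iff _).2 hy
  · apply le_generateFrom
    rintro _ ⟨c, r, hr, rfl⟩
    rw [hb, isOpen_iff_mem_nhds]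
    intro x hx
    rw [Valued.mem_nhds]
    refine ⟨Units.mk0 (vK.v.restrict r) (by simpa using hr), fun y hy => ?_⟩
    have hy' : A.valuation (y - x) < A.valuation r := (Valuation.restrict_lt_iff _).1 hy
    have := A.valuation.map_add (y - x) (x - c)
    rw [sub_add_sub_cancel] at this
    exact this.trans_lt (max_lt hy' hx)

theorem isTopologicalRing_ballTopology {O : Set K} (hO : IsUnitBall O) :
    @IsTopologicalRing K (ballTopology O) _ := by
  rcases hO with ⟨i, j, rfl⟩ | ⟨A, -, rfl⟩
  · rw [ballTopology_Icc]
    let _ : TopologicalSpace K := Preorder.topology K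
    have _ : OrderTopology K := ⟨rfl⟩
    infer_instance
  · rw [ballTopology_valuationSubring]
    let _ := Valued.mk' A.valuation
    infer_instance

end Topology

/-! ### Expansions of ordered and valued fields -/

section Expansion

variable {L : FirstOrder.Language.{u, v}}

/-- The interpretation of the predicate symbol of `ringBall` in an `L`-structure. -/
def unitBall (ι : ringBall →ᴸ L) (K : Type w) [L.Structure K] : Set K :=
  {a | Structure.RelMap (ι.onRelation BallRel.ball) ![a]}

/-- Let `L` be a language extending `ringBall`. The `L`-structure on the field `K` is an expansion
of an ordered or valued field: the ring symbols are interpreted by the ring operations of `K`, and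
the predicate symbol is interpreted by the unit interval of an order, or by the ring of a
non-trivial valuation. -/
class IsFieldExpansion (ι : ringBall →ᴸ L) (K : Type w) [Field K] [L.Structure K] : Prop where
  funMap_eq : ∀ {n : ℕ} (f : ringFunc n) (x : Fin n → K),
    Structure.funMap (ι.onFunction f) x = ringOp f x
  isUnitBall : IsUnitBall (unitBall ι K)

variable (ι : ringBall →ᴸ L)

/-- Every definable subset of `K` that is closed, bounded and discrete, is finite
("definable" allows parameters from `K`). -/
def BFin (K : Type w) [Field K] [L.Structure K] : Prop :=
  letI := ballTopology (unitBall ι K)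
  ∀ S : Set K, (Set.univ : Set K).Definable₁ L S → IsClosed S → IsBddSet (unitBall ι K) S →
    IsDiscrete S → S.Finite

variable {K : Type w} [L.Structure K] {m : ℕ}

/-- The graph in `K^(m+1)` of a function on a subset of `K^m`. -/
def graph {X : Set (Fin m → K)} (f : X → K) : Set (Fin (m + 1) → K) :=
  {z | ∃ h : Fin.init z ∈ X, f ⟨Fin.init z, h⟩ = z (Fin.last m)}

theorem definable_graph_funMap {X : Set (Fin m → K)} (hX : (Set.univ : Set K).Definable L X)
    {n : ℕ} (F : L.Functions n) (f : Fin n → X → K)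
    (hf : ∀ i, (Set.univ : Set K).Definable L (graph (f i))) :
    (Set.univ : Set K).Definable L (graph fun x => Structure.funMap F fun i => f i x) := by
  let σ : Fin n → Fin (m + 1) → Fin (m + 1) ⊕ Fin n := fun i =>
    Fin.lastCases (Sum.inr i) (fun l => Sum.inl l.castSucc)
  have h1 : (Set.univ : Set K).Definable L
      {w : Fin (m + 1) ⊕ Fin n → K | ∀ i, w ∘ σ i ∈ graph (f i)} := by
    rw [ofPred_forall]
    exact definable_iInter_of_finite fun i => (hf i).preimage_comp (σ i)
  have h2 : (Set.univ : Set K).Definable L {w : Fin (m + 1) ⊕ Fin n → K |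
      Structure.funMap F (fun i => w (Sum.inr i)) = w (Sum.inl (Fin.last m))} := by
    have := (Term.func F fun i => Term.var (Sum.inr i) :
      L.Term (Fin (m + 1) ⊕ Fin n)).definableFun_realize (M := K)
    exact (DefinableFun.of_empty this).ofPred_eq (DefinableFun.proj L)
  have h3 := Definable.inter (hX.preimage_comp Fin.castSucc) (h1.inter h2).exists_of_finite
  convert! h3 using 1
  ext z
  have hσ : ∀ (a : Fin n → K) i, Sum.elim z a ∘ σ i = Fin.snoc (Fin.init z) (a i) := by
    intro a i
    ext l
    refine Fin.lastCases ?_ (fun l => ?_) l <;> simp [σ, Fin.init]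
  simp only [graph, mem_inter_iff, mem_preimage, mem_ofPred_eq, hσ, Fin.init_snoc, Fin.snoc_last,
    Sum.elim_inr, Sum.elim_inl]
  constructor
  · rintro ⟨h, hz⟩
    exact ⟨h, fun i => f i ⟨_, h⟩, fun i => ⟨h, rfl⟩, hz⟩
  · rintro ⟨h, a, ha, hz⟩
    refine ⟨h, ?_⟩
    rw [← hz]
    congr 1
    ext i
    exact (ha i).2

variable [Field K]

/-- `f` is continuous and definable with parameters. -/
def IsDefCont {X : Set (Fin m → K)} (f : X → K) : Prop :=
  letI := ballTopology (unitBall ι K)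
  Continuous f ∧ (Set.univ : Set K).Definable L (graph f)

theorem isDefCont_ringOp [IsFieldExpansion ι K] {X : Set (Fin m → K)}
    (hX : (Set.univ : Set K).Definable L X) {n : ℕ} (F : ringFunc n) (f : Fin n → X → K)
    (hf : ∀ i, IsDefCont ι (f i)) : IsDefCont ι fun x => ringOp F fun i => f i x := by
  let _ := ballTopology (unitBall ι K)
  have := isTopologicalRing_ballTopology (IsFieldExpansion.isUnitBall (ι := ι) (K := K))
  constructor
  · have hc : ∀ i, Continuous (f i) := fun i => (hf i).1
    cases F
    · exact (hc 0).add (hc 1)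
    · exact (hc 0).mul (hc 1)
    · exact (hc 0).neg
    · exact continuous_const
    · exact continuous_const
  · have := definable_graph_funMap hX (ι.onFunction F) f fun i => (hf i).2
    simpa only [IsFieldExpansion.funMap_eq] using this

/-- The ring `𝒞(X)` of continuous definable functions on the definable set `X ⊆ K^m`, with
pointwise operations. -/
def C [IsFieldExpansion ι K] (X : L.DefinableSet (Set.univ : Set K) (Fin m)) :
    Subring (↥(X : Set (Fin m → K)) → K) where
  carrier := {f | IsDefCont ι f}
  zero_mem' := isDefCont_ringOp ι X.2 .zero ![] (fun i => i.elim0)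
  one_mem' := isDefCont_ringOp ι X.2 .one ![] (fun i => i.elim0)
  add_mem' := fun {f g} hf hg =>
    isDefCont_ringOp ι X.2 .add ![f, g] (Fin.forall_fin_two.2 ⟨hf, hg⟩)
  mul_mem' := fun {f g} hf hg =>
    isDefCont_ringOp ι X.2 .mul ![f, g] (Fin.forall_fin_two.2 ⟨hf, hg⟩)
  neg_mem' := fun {f} hf =>
    isDefCont_ringOp ι X.2 .neg ![f] (Fin.forall_fin_one.2 hf)

/-- The structure `(𝒞(X), ℬ)`, where `ℬ` is the set of `s ∈ 𝒞(X)` with values in `𝒪`. -/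
instance ringBallStructureC [IsFieldExpansion ι K] (X : L.DefinableSet (Set.univ : Set K) (Fin m)) :
    ringBall.Structure (C ι X) :=
  ringBallStructure (C ι X) {s | ∀ x, s.1 x ∈ unitBall ι K}

/-! ### Germs -/

/-- The zero set of a function on a subset of `K^m`, as a subset of `K^m`. -/
def zeroSet {X : Set (Fin m → K)} (s : X → K) : Set (Fin m → K) :=
  {x | ∃ h : x ∈ X, s ⟨x, h⟩ = 0}

/-- `s` vanishes on a germ at `p₀`: it has a non-isolated zero at `p₀`. -/
def VanishesOnGerm {U : Set (Fin m → K)} (p₀ : Fin m → K) (s : U → K) : Prop :=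
  letI := ballTopology (unitBall ι K)
  p₀ ∈ zeroSet s ∧ AccPt p₀ (Filter.principal (zeroSet s))

/-- The functions `s₁, …, s_k` vanish on separated germs at `p₀`, with separating functions
`δ₁, …, δ_k` in `𝒞(U \ {p₀})`. -/
def VanishOnSeparatedGerms {U : Set (Fin m → K)} (p₀ : Fin m → K) {k : ℕ}
    (s : Fin k → U → K) : Prop :=
  ∃ δ : Fin k → (U \ {p₀} : Set (Fin m → K)) → K,
    (∀ i, IsDefCont ι (δ i)) ∧
    (∀ i j, i ≠ j → Disjoint (zeroSet (s i) \ {p₀}) (zeroSet (s j) \ {p₀})) ∧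
    (∀ i, VanishesOnGerm ι p₀ (s i)) ∧
    (∀ i j, i ≠ j →
      (∀ x : (U \ {p₀} : Set (Fin m → K)), x.1 ∈ zeroSet (s i) \ {p₀} → δ i x = 1) ∧
      (∀ x : (U \ {p₀} : Set (Fin m → K)), x.1 ∈ zeroSet (s j) \ {p₀} → δ i x = 0)) ∧
    (∀ i, IsBddSet (unitBall ι K) (Set.range (δ i)))

/-- `X` has arbitrarily many germs at `p₀`: for every positive integer `k` there are a definable
neighborhood `U` of `p₀` in `X` and `k` functions in `𝒞(U)` that vanish on separated germs
at `p₀`. -/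
def HasArbitrarilyManyGerms (X : Set (Fin m → K)) (p₀ : Fin m → K) : Prop :=
  letI := ballTopology (unitBall ι K)
  p₀ ∈ X ∧ ∀ k : ℕ, 0 < k → ∃ U : Set (Fin m → K),
    U ⊆ X ∧ (Set.univ : Set K).Definable L U ∧ U ∈ 𝓝[X] p₀ ∧
    ∃ s : Fin k → U → K, (∀ i, IsDefCont ι (s i)) ∧ VanishOnSeparatedGerms ι p₀ s

/-! ### The natural embedding -/

/-- The subset of `N^α` defined by the formula `φ`, whose parameters from `K` are interpreted in
`N` by means of the map `j : K → N`. -/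
def solutionSet {N : Type*} [L.Structure N] {α : Type*} (j : K → N) (φ : L.Formula (K ⊕ α)) :
    Set (α → N) :=
  {x | φ.Realize (Sum.elim j x)}

/-- `e : 𝒞(X) → 𝒞(X')` is the natural map with respect to `j : K → K'`: whenever a formula with
parameters from `K` defines the graph of `f`, the same formula defines in `K'` the graph
of `e f`. -/
def IsNaturalMap {K' : Type*} [Field K'] [L.Structure K'] [IsFieldExpansion ι K]
    [IsFieldExpansion ι K'] {X : L.DefinableSet (Set.univ : Set K) (Fin m)}
    {X' : L.DefinableSet (Set.univ : Set K') (Fin m)} (j : K → K')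
    (e : C ι X → C ι X') : Prop :=
  ∀ (f : C ι X) (ψ : L.Formula (K ⊕ Fin (m + 1))),
    solutionSet id ψ = graph f.1 → solutionSet j ψ = graph (e f).1

end Expansion

end DefCont

/-! A single ring formula with the predicate `ℬ`, called `IsArch`, detects whether the powers of a
constant `σ` with `|σ| < 1` enter every ball around zero. With `σ = τ` or `σ = τ⁻¹` it holds in
`𝒞(X)` and fails in `𝒞(X')`, so no elementary embedding sends the constant `σ` to the constant `j
σ`, as the natural map does.

Geometry becomes algebra because two functions generate the unit ideal exactly when they have no
common zero (`exists_mul_add_mul_eq_one`), and because every point of `X` is the zero set of one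
function (`exists_zero_iff_eq`). Hence points, vanishing at a point and, by means of a multiplier
from `ℬ`, the relation `|f| ≤ |g|` at a point are first-order. If `h` vanishes exactly at `p`, the
ring therefore sees the set `Λ` of limits at `p` of `g / h` along the zero set of `s`.

`IsArch σ` asks for some such `h` so that for each `ε` with `ε(p) ≠ 0` there are `s, g` with the
following properties: `1 ∈ Λ`; if `γ ∈ Λ` and `|γ| > |ε(p)|` then `σγ ∈ Λ`; each element of the
field has a neighborhood meeting `Λ` in at most that element. The last property makes `Λ` closed and
discrete.

Under (BFin) the definable set `Λ ∩ 𝒪` is finite, so it cannot contain all the distinct powers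
`σ^n`, and some `|σ^n| ≤ |ε(p)|` (`exists_absLE_of_isArch`). Conversely, functions that vanish on
separated germs allow any finite set to be realised as `Λ` (`exists_isLim_iff`). If `|σ^n| ≤
|ε(p)|`, then `Λ = {1, σ, …, σ^(n+1)}` is as required (`isArch_of_germs`).

The natural map is obtained by transfer. `DefPair` records that two predicates, one on each
structure, come from one formula; it is stable under the logical operations and under substitution
of definable functions, and an elementary embedding preserves it. Existence, uniqueness, injectivity
and compatibility with the ring operations and `ℬ` are all transferred sentences about graphs. -/

namespace DefCont

open FirstOrder.Language Set

/-! ### Pairs of predicates defined by the same formula in two structures -/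

section DefPair

variable (L : FirstOrder.Language.{u, v}) {M : Type*} {N : Type*} [L.Structure M] [L.Structure N]
  {A : Type*} {α β : Type*}

/-- The predicates `P` on `M^α` and `Q` on `N^α` are defined by the same formula, whose parameters
in `A` are interpreted by `a` in `M` and by `b` in `N`. -/
def DefPair (a : A → M) (b : A → N) (P : (α → M) → Prop) (Q : (α → N) → Prop) : Prop :=
  ∃ φ : L.Formula (A ⊕ α), (∀ v, φ.Realize (Sum.elim a v) ↔ P v) ∧
    ∀ v, φ.Realize (Sum.elim b v) ↔ Q v

/-- The functions `t` and `t'` have graphs that are defined by the same formula. -/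
def FunPair (a : A → M) (b : A → N) (t : (α → M) → M) (t' : (α → N) → N) : Prop :=
  DefPair L a b (fun w : α ⊕ Unit → M => t (fun i => w (Sum.inl i)) = w (Sum.inr ()))
    (fun w : α ⊕ Unit → N => t' (fun i => w (Sum.inl i)) = w (Sum.inr ()))

variable {L} {a : A → M} {b : A → N}

namespace DefPair

variable {P P₁ P₂ : (α → M) → Prop} {Q Q₁ Q₂ : (α → N) → Prop}

theorem not (h : DefPair L a b P Q) : DefPair L a b (fun v => ¬ P v) (fun v => ¬ Q v) := by
  obtain ⟨φ, h1, h2⟩ := h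
  exact ⟨∼φ, fun v => by rw [Formula.realize_not, h1], fun v => by rw [Formula.realize_not, h2]⟩

theorem and (h : DefPair L a b P₁ Q₁) (h' : DefPair L a b P₂ Q₂) :
    DefPair L a b (fun v => P₁ v ∧ P₂ v) (fun v => Q₁ v ∧ Q₂ v) := by
  obtain ⟨φ, h1, h2⟩ := h
  obtain ⟨ψ, h3, h4⟩ := h'
  exact ⟨φ ⊓ ψ, fun v => by rw [Formula.realize_inf, h1, h3],
    fun v => by rw [Formula.realize_inf, h2, h4]⟩

theorem congr (h : DefPair L a b P₁ Q₁) (hP : ∀ v, P v ↔ P₁ v) (hQ : ∀ v, Q v ↔ Q₁ v) :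
    DefPair L a b P Q := by
  rw [funext fun v => propext (hP v), funext fun v => propext (hQ v)]
  exact h

theorem imp (h : DefPair L a b P₁ Q₁) (h' : DefPair L a b P₂ Q₂) :
    DefPair L a b (fun v => P₁ v → P₂ v) (fun v => Q₁ v → Q₂ v) :=
  (h.and h'.not).not.congr (fun _ => by tauto) (fun _ => by tauto)

theorem or (h : DefPair L a b P₁ Q₁) (h' : DefPair L a b P₂ Q₂) :
    DefPair L a b (fun v => P₁ v ∨ P₂ v) (fun v => Q₁ v ∨ Q₂ v) :=
  (h.not.and h'.not).not.congr (fun _ => by tauto) (fun _ => by tauto)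

theorem relabel (σ : α → β) (h : DefPair L a b P Q) :
    DefPair L a b (fun w : β → M => P fun i => w (σ i)) (fun w : β → N => Q fun i => w (σ i)) := by
  obtain ⟨φ, h1, h2⟩ := h
  refine ⟨φ.relabel (Sum.map id σ), fun v => ?_, fun v => ?_⟩
  · rw [Formula.realize_relabel, Sum.elim_comp_map, Function.comp_id]
    exact h1 _
  · rw [Formula.realize_relabel, Sum.elim_comp_map, Function.comp_id]
    exact h2 _

theorem forall_finite [Finite β] {P : β → (α → M) → Prop} {Q : β → (α → N) → Prop}
    (h : ∀ i, DefPair L a b (P i) (Q i)) :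
    DefPair L a b (fun v => ∀ i, P i v) (fun v => ∀ i, Q i v) := by
  choose φ h1 h2 using h
  refine ⟨Formula.iInf φ, fun v => ?_, fun v => ?_⟩ <;> rw [Formula.realize_iInf]
  · exact forall_congr' fun i => h1 i v
  · exact forall_congr' fun i => h2 i v

theorem exists_fun [Finite β] {P : (α → M) → (β → M) → Prop} {Q : (α → N) → (β → N) → Prop}
    (h : DefPair L a b (fun w : α ⊕ β → M => P (fun i => w (Sum.inl i)) (fun i => w (Sum.inr i)))
      (fun w : α ⊕ β → N => Q (fun i => w (Sum.inl i)) (fun i => w (Sum.inr i)))) :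
    DefPair L a b (fun v => ∃ x, P v x) (fun v => ∃ x, Q v x) := by
  obtain ⟨φ, h1, h2⟩ := h
  refine ⟨(φ.relabel (Equiv.sumAssoc A α β).symm).iExs β, fun v => ?_, fun v => ?_⟩
  · rw [Formula.realize_iExs]
    refine exists_congr fun x => ?_
    rw [Formula.realize_relabel]
    refine Iff.trans (iff_of_eq (congrArg _ ?_)) (h1 (Sum.elim v x))
    ext (_ | _ | _) <;> rfl
  · rw [Formula.realize_iExs]
    refine exists_congr fun x => ?_
    rw [Formula.realize_relabel]
    refine Iff.trans (iff_of_eq (congrArg _ ?_)) (h2 (Sum.elim v x))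
    ext (_ | _ | _) <;> rfl

theorem forall_fun [Finite β] {P : (α → M) → (β → M) → Prop} {Q : (α → N) → (β → N) → Prop}
    (h : DefPair L a b (fun w : α ⊕ β → M => P (fun i => w (Sum.inl i)) (fun i => w (Sum.inr i)))
      (fun w : α ⊕ β → N => Q (fun i => w (Sum.inl i)) (fun i => w (Sum.inr i)))) :
    DefPair L a b (fun v => ∀ x, P v x) (fun v => ∀ x, Q v x) :=
  (DefPair.exists_fun (P := fun v x => ¬ P v x) (Q := fun v x => ¬ Q v x) h.not).not.congr
    (fun _ => by simp) (fun _ => by simp)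

theorem ex {P : (α → M) → M → Prop} {Q : (α → N) → N → Prop}
    (h : DefPair L a b (fun w : α ⊕ Unit → M => P (fun i => w (Sum.inl i)) (w (Sum.inr ())))
      (fun w : α ⊕ Unit → N => Q (fun i => w (Sum.inl i)) (w (Sum.inr ())))) :
    DefPair L a b (fun v => ∃ x, P v x) (fun v => ∃ x, Q v x) :=
  (DefPair.exists_fun (β := Unit) (P := fun v x => P v (x ())) (Q := fun v x => Q v (x ())) h).congr
    (fun _ => ⟨fun ⟨x, hx⟩ => ⟨fun _ => x, hx⟩, fun ⟨x, hx⟩ => ⟨x (), hx⟩⟩)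
    (fun _ => ⟨fun ⟨x, hx⟩ => ⟨fun _ => x, hx⟩, fun ⟨x, hx⟩ => ⟨x (), hx⟩⟩)

theorem all {P : (α → M) → M → Prop} {Q : (α → N) → N → Prop}
    (h : DefPair L a b (fun w : α ⊕ Unit → M => P (fun i => w (Sum.inl i)) (w (Sum.inr ())))
      (fun w : α ⊕ Unit → N => Q (fun i => w (Sum.inl i)) (w (Sum.inr ())))) :
    DefPair L a b (fun v => ∀ x, P v x) (fun v => ∀ x, Q v x) :=
  (DefPair.ex (P := fun v x => ¬ P v x) (Q := fun v x => ¬ Q v x) h.not).not.congr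
    (fun _ => by simp) (fun _ => by simp)

/-- The values of the substituted functions are named by existentially quantified variables. Since
only the graphs of these functions need to be definable, they may be arbitrary definable functions
and not just terms. -/
theorem comp [Finite β] {P : (β → M) → Prop} {Q : (β → N) → Prop} (h : DefPair L a b P Q)
    {t : β → (α → M) → M} {t' : β → (α → N) → N} (ht : ∀ i, FunPair L a b (t i) (t' i)) :
    DefPair L a b (fun v => P fun i => t i v) (fun v => Q fun i => t' i v) := by
  have h1 : DefPair L a b (fun v => ∃ y : β → M, (∀ i, t i v = y i) ∧ P y)
      (fun v => ∃ y : β → N, (∀ i, t' i v = y i) ∧ Q y) := by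
    refine .exists_fun (.and (.forall_finite fun i => ?_) (h.relabel Sum.inr))
    exact (ht i).relabel (Sum.elim Sum.inl fun _ => Sum.inr i)
  refine h1.congr (fun v => ⟨fun h => ⟨_, fun _ => rfl, h⟩, ?_⟩)
    (fun v => ⟨fun h => ⟨_, fun _ => rfl, h⟩, ?_⟩)
  all_goals
    rintro ⟨y, hy, h⟩
    rwa [← funext hy] at h

theorem rel {n : ℕ} (R : L.Relations n) :
    DefPair L a b (fun v : Fin n → M => Structure.RelMap R v)
      (fun v : Fin n → N => Structure.RelMap R v) :=
  ⟨R.formula fun i => Term.var (Sum.inr i), fun v => by rw [Formula.realize_rel]; rfl,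
    fun v => by rw [Formula.realize_rel]; rfl⟩

theorem eq_var (i k : α) :
    DefPair L a b (fun v : α → M => v i = v k) (fun v : α → N => v i = v k) :=
  ⟨(Term.var (Sum.inr i)).equal (Term.var (Sum.inr k)), fun v => by simp [Formula.realize_equal],
    fun v => by simp [Formula.realize_equal]⟩

end DefPair

namespace FunPair

variable {t t₁ t₂ : (α → M) → M} {t' t₁' t₂' : (α → N) → N}

theorem var (i : α) : FunPair L a b (fun v : α → M => v i) (fun v : α → N => v i) :=
  DefPair.eq_var _ _

theorem const (x : A) : FunPair L a b (fun _ : α → M => a x) (fun _ : α → N => b x) :=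
  ⟨(Term.var (Sum.inl x)).equal (Term.var (Sum.inr (Sum.inr ()))),
    fun v => by simp [Formula.realize_equal], fun v => by simp [Formula.realize_equal]⟩

theorem relabel (σ : α → β) (h : FunPair L a b t t') :
    FunPair L a b (fun w : β → M => t fun i => w (σ i)) (fun w : β → N => t' fun i => w (σ i)) :=
  DefPair.relabel (Sum.map σ id) h

theorem comp [Finite β] {F : (β → M) → M} {F' : (β → N) → N} (h : FunPair L a b F F')
    {t : β → (α → M) → M} {t' : β → (α → N) → N} (ht : ∀ i, FunPair L a b (t i) (t' i)) :
    FunPair L a b (fun v => F fun i => t i v) (fun v => F' fun i => t' i v) := by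
  refine DefPair.comp (P := fun w : β ⊕ Unit → M => F (fun i => w (Sum.inl i)) = w (Sum.inr ()))
    (Q := fun w : β ⊕ Unit → N => F' (fun i => w (Sum.inl i)) = w (Sum.inr ())) h
    (t := Sum.elim (fun i w => t i fun k => w (Sum.inl k)) fun _ w => w (Sum.inr ()))
    (t' := Sum.elim (fun i w => t' i fun k => w (Sum.inl k)) fun _ w => w (Sum.inr ())) ?_
  rintro (i | i)
  · exact (ht i).relabel _
  · exact .var _

theorem comp₂ {F : M → M → M} {F' : N → N → N}
    (h : FunPair L a b (fun v : Fin 2 → M => F (v 0) (v 1)) (fun v : Fin 2 → N => F' (v 0) (v 1)))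
    (h₁ : FunPair L a b t₁ t₁') (h₂ : FunPair L a b t₂ t₂') :
    FunPair L a b (fun v => F (t₁ v) (t₂ v)) (fun v => F' (t₁' v) (t₂' v)) :=
  h.comp (t := ![t₁, t₂]) (t' := ![t₁', t₂']) (Fin.forall_fin_two.2 ⟨h₁, h₂⟩)

theorem funMap {n : ℕ} (F : L.Functions n) : FunPair L a b
    (fun v : Fin n → M => Structure.funMap F v) (fun v : Fin n → N => Structure.funMap F v) := by
  refine ⟨(Term.func F fun i => Term.var (Sum.inr (Sum.inl i))).equal
    (Term.var (Sum.inr (Sum.inr ()))), fun v => ?_, fun v => ?_⟩ <;>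
  simp [Formula.realize_equal]

theorem eq (h₁ : FunPair L a b t₁ t₁') (h₂ : FunPair L a b t₂ t₂') :
    DefPair L a b (fun v => t₁ v = t₂ v) (fun v => t₁' v = t₂' v) := by
  have h : DefPair L a b (fun v => ∃ y, t₁ v = y ∧ t₂ v = y) (fun v => ∃ y, t₁' v = y ∧ t₂' v = y) :=
    .ex (h₁.and h₂)
  exact h.congr (fun v => by simp [eq_comm]) (fun v => by simp [eq_comm])

theorem ite {P : (α → M) → Prop} {Q : (α → N) → Prop} (h : DefPair L a b P Q)
    (h₁ : FunPair L a b t₁ t₁') (h₂ : FunPair L a b t₂ t₂') [∀ v, Decidable (P v)]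
    [∀ v, Decidable (Q v)] :
    FunPair L a b (fun v => if P v then t₁ v else t₂ v) (fun v => if Q v then t₁' v else t₂' v) := by
  have h := DefPair.and ((h.relabel (Sum.inl (β := Unit))).imp h₁)
    ((h.relabel (Sum.inl (β := Unit))).not.imp h₂)
  refine h.congr (fun v => ?_) (fun v => ?_) <;> dsimp only <;> split_ifs with h <;> simp [h]

end FunPair

theorem DefPair.eq {t₁ t₂ : (α → M) → M} {t₁' t₂' : (α → N) → N}
    (h₁ : FunPair L a b t₁ t₁') (h₂ : FunPair L a b t₂ t₂') :
    DefPair L a b (fun v => t₁ v = t₂ v) (fun v => t₁' v = t₂' v) :=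
  FunPair.eq h₁ h₂

/-- Definability with parameters is the diagonal case, so that one calculus serves both for
definability in one structure and for transfer between two. -/
theorem definable_iff_defPair {S : Set (α → M)} :
    (Set.univ : Set M).Definable L S ↔
      DefPair L (id : M → M) (id : M → M) (fun v => v ∈ S) (fun v => v ∈ S) := by
  rw [Set.definable_iff_exists_formula_sum]
  constructor
  · rintro ⟨φ, rfl⟩
    have h : ∀ v, (φ.relabel (Sum.map Subtype.val id)).Realize (Sum.elim id v) ↔
        φ.Realize (Sum.elim (Subtype.val : ↥(Set.univ : Set M) → M) v) := fun v => by
      rw [Formula.realize_relabel, Sum.elim_comp_map]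
      rfl
    exact ⟨φ.relabel (Sum.map Subtype.val id), h, h⟩
  · rintro ⟨φ, h, -⟩
    refine ⟨φ.relabel (Sum.map (fun x => (⟨x, trivial⟩ : ↥(Set.univ : Set M))) id), ?_⟩
    ext v
    rw [mem_ofPred_eq, Formula.realize_relabel, Sum.elim_comp_map]
    exact (h v).symm

theorem DefPair.definable_right {P : (α → M) → Prop} {Q : (α → N) → Prop} (h : DefPair L a b P Q) :
    (Set.univ : Set N).Definable L {v | Q v} := by
  obtain ⟨φ, -, h⟩ := h
  rw [definable_iff_defPair]
  have h' : ∀ v, (φ.relabel (Sum.map b id)).Realize (Sum.elim id v) ↔ Q v := fun v => by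
    rw [Formula.realize_relabel, Sum.elim_comp_map]
    exact h v
  exact ⟨φ.relabel (Sum.map b id), h', h'⟩

/-- Elementary embeddings preserve predicates that are defined by the same formula. -/
theorem DefPair.iff_of_elementary {j : M ↪ₑ[L] N} {P : (α → M) → Prop} {Q : (α → N) → Prop}
    (h : DefPair L a (fun x => j (a x)) P Q) (v : α → M) : Q (fun i => j (v i)) ↔ P v := by
  obtain ⟨φ, h1, h2⟩ := h
  rw [← h1, ← h2, ← j.map_formula]
  refine iff_of_eq (congrArg _ ?_)
  ext (_ | _) <;> rfl

end DefPair

/-! ### Absolute values -/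

section AbsoluteValue

variable {K : Type w} [Field K] {O : Set K}

/-- The ordered and the valued case share a multiplicative absolute value, with values in the
non-negative elements or in the value group. Facts that do not involve addition are deduced from it
for both cases at once. -/
theorem IsUnitBall.exists_monoidWithZeroHom (hO : IsUnitBall O) :
    ∃ (Γ : Type w) (_ : LinearOrderedCommGroupWithZero Γ) (φ : K →*₀ Γ),
      ∀ y x, AbsLE O y x ↔ φ y ≤ φ x := by
  rcases hO with ⟨i, j, rfl⟩ | ⟨A, -, rfl⟩
  · refine ⟨{x : K // 0 ≤ x}, inferInstance,
      { toFun := fun x => ⟨|x|, abs_nonneg x⟩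
        map_zero' := Subtype.ext abs_zero
        map_one' := Subtype.ext abs_one
        map_mul' := fun x y => Subtype.ext (abs_mul x y) }, fun y x => absLE_Icc y x⟩
  · exact ⟨A.ValueGroup, inferInstance, A.valuation.toMonoidWithZeroHom, absLE_valuationSubring A⟩

theorem mem_iff_absLE_one {x : K} : x ∈ O ↔ AbsLE O x 1 :=
  ⟨fun h => ⟨x, h, (one_mul x).symm⟩, fun ⟨a, ha, h⟩ => by rwa [h, one_mul]⟩

theorem absLE_refl (hO : IsUnitBall O) (x : K) : AbsLE O x x := by
  obtain ⟨Γ, _, φ, h⟩ := hO.exists_monoidWithZeroHom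
  rw [h]

theorem absLE_trans (hO : IsUnitBall O) {x y z : K} (h₁ : AbsLE O x y) (h₂ : AbsLE O y z) :
    AbsLE O x z := by
  obtain ⟨Γ, _, φ, h⟩ := hO.exists_monoidWithZeroHom
  rw [h] at *
  exact h₁.trans h₂

theorem not_absLE (hO : IsUnitBall O) {x y : K} : ¬ AbsLE O x y ↔ AbsLT O y x := by
  obtain ⟨Γ, _, φ, h⟩ := hO.exists_monoidWithZeroHom
  simp only [AbsLT, h, not_le, iff_and_self]
  exact le_of_lt

theorem absLE_zero (hO : IsUnitBall O) (x : K) : AbsLE O 0 x := by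
  obtain ⟨Γ, _, φ, h⟩ := hO.exists_monoidWithZeroHom
  rw [h, map_zero]
  exact zero_le

theorem absLE_zero_iff {x : K} (hO : IsUnitBall O) : AbsLE O x 0 ↔ x = 0 := by
  obtain ⟨Γ, _, φ, h⟩ := hO.exists_monoidWithZeroHom
  rw [h, map_zero, le_zero_iff, map_eq_zero]

theorem absLE_mul (hO : IsUnitBall O) {x y x' y' : K} (h₁ : AbsLE O x y) (h₂ : AbsLE O x' y') :
    AbsLE O (x * x') (y * y') := by
  obtain ⟨Γ, _, φ, h⟩ := hO.exists_monoidWithZeroHom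
  rw [h] at *
  rw [map_mul, map_mul]
  exact mul_le_mul' h₁ h₂

theorem absLE_mul_right_iff (hO : IsUnitBall O) {x y z : K} (hz : z ≠ 0) :
    AbsLE O (x * z) (y * z) ↔ AbsLE O x y := by
  obtain ⟨Γ, _, φ, h⟩ := hO.exists_monoidWithZeroHom
  rw [h, h, map_mul, map_mul, mul_le_mul_iff_left₀]
  exact zero_lt_iff.2 ((map_ne_zero φ).2 hz)

theorem absLT_mul_right_iff (hO : IsUnitBall O) {x y z : K} (hz : z ≠ 0) :
    AbsLT O (x * z) (y * z) ↔ AbsLT O x y := by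
  rw [← not_absLE hO, absLE_mul_right_iff hO hz, not_absLE hO]

theorem AbsLT.trans_absLE (hO : IsUnitBall O) {x y z : K} (h₁ : AbsLT O x y) (h₂ : AbsLE O y z) :
    AbsLT O x z := by
  obtain ⟨Γ, _, φ, h⟩ := hO.exists_monoidWithZeroHom
  rw [← not_absLE hO, h, not_le] at h₁ ⊢
  rw [h] at h₂
  exact h₁.trans_le h₂

theorem AbsLE.trans_absLT (hO : IsUnitBall O) {x y z : K} (h₁ : AbsLE O x y) (h₂ : AbsLT O y z) :
    AbsLT O x z := by
  obtain ⟨Γ, _, φ, h⟩ := hO.exists_monoidWithZeroHom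
  rw [← not_absLE hO, h, not_le] at h₂ ⊢
  rw [h] at h₁
  exact h₁.trans_lt h₂

theorem absLT_mul_of_absLT_one (hO : IsUnitBall O) {x y : K} (hx : AbsLT O x 1) (hy : y ≠ 0) :
    AbsLT O (x * y) y := by
  simpa using (absLT_mul_right_iff hO hy).2 hx

theorem AbsLT.ne_zero (hO : IsUnitBall O) {x y : K} (h : AbsLT O x y) : y ≠ 0 := by
  rintro rfl
  exact h.2 (absLE_zero hO x)

theorem absLT_zero_left (hO : IsUnitBall O) {y : K} (hy : y ≠ 0) : AbsLT O 0 y := by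
  rw [← not_absLE hO, absLE_zero_iff hO]
  exact hy

theorem absLE_pow_pow (hO : IsUnitBall O) {x : K} (hx : AbsLE O x 1) {m n : ℕ} (h : m ≤ n) :
    AbsLE O (x ^ n) (x ^ m) := by
  obtain ⟨Γ, _, φ, hφ⟩ := hO.exists_monoidWithZeroHom
  rw [hφ, map_one] at hx
  rw [hφ, map_pow, map_pow]
  exact pow_le_pow_right_of_le_one' hx h

theorem pow_ne_one_of_absLT (hO : IsUnitBall O) {x : K} (hx : AbsLT O x 1) {n : ℕ} (hn : n ≠ 0) :
    x ^ n ≠ 1 := by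
  obtain ⟨Γ, _, φ, hφ⟩ := hO.exists_monoidWithZeroHom
  rw [← not_absLE hO, hφ, map_one, not_le] at hx
  intro h
  have := congrArg φ h
  rw [map_pow, map_one] at this
  exact (pow_lt_one₀ zero_le hx hn).ne this

theorem pow_injective_of_absLT (hO : IsUnitBall O) {x : K} (hx : AbsLT O x 1) (h0 : x ≠ 0) :
    Function.Injective fun n : ℕ => x ^ n := by
  have key : ∀ m n : ℕ, m < n → x ^ m ≠ x ^ n := by
    intro m n hmn h
    obtain ⟨k, rfl⟩ := Nat.exists_eq_add_of_le hmn.le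
    rw [pow_add, left_eq_mul₀ (pow_ne_zero _ h0)] at h
    exact pow_ne_one_of_absLT hO hx (by omega) h
  intro m n h
  by_contra hne
  rcases lt_or_gt_of_ne hne with hlt | hlt
  · exact key _ _ hlt h
  · exact key _ _ hlt h.symm

theorem exists_ne_zero_absLT_one (hO : IsUnitBall O) : ∃ x : K, x ≠ 0 ∧ AbsLT O x 1 := by
  rcases hO with ⟨i, j, rfl⟩ | ⟨A, hA, rfl⟩
  · refine ⟨2⁻¹, by simp, ?_⟩
    rw [AbsLT, absLE_Icc, absLE_Icc, abs_inv]
    norm_num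
  · have : ∃ x, x ∉ A := by
      by_contra! hall
      exact hA (top_unique fun x _ => hall x)
    obtain ⟨x, hx⟩ := this
    have hx0 : x ≠ 0 := by
      rintro rfl
      exact hx A.zero_mem
    refine ⟨x⁻¹, inv_ne_zero hx0, ?_⟩
    rw [← A.valuation_le_one_iff, not_le] at hx
    simp only [AbsLT, absLE_valuationSubring, not_le, map_one, map_inv₀]
    exact ⟨(inv_lt_one_of_one_lt₀ hx).le, inv_lt_one_of_one_lt₀ hx⟩

theorem exists_absLE_of_finite (hO : IsUnitBall O) {κ : Type*} [Finite κ] {r : κ → K}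
    (hr : ∀ i, r i ≠ 0) : ∃ d : K, d ≠ 0 ∧ ∀ i, AbsLE O d (r i) := by
  obtain ⟨Γ, _, φ, hφ⟩ := hO.exists_monoidWithZeroHom
  rcases isEmpty_or_nonempty κ with _ | _
  · exact ⟨1, one_ne_zero, fun i => isEmptyElim i⟩
  · obtain ⟨i, hi⟩ := Finite.exists_min fun i => φ (r i)
    exact ⟨r i, hr i, fun k => (hφ _ _).2 (hi k)⟩

/-- The square matters in the ordered case: `1 - y * y` lies between `0` and `1`, while `1 - y` can
be as large as `2`. -/
theorem one_sub_mul_self_mem (hO : IsUnitBall O) {y : K} (hy : AbsLE O y 1) :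
    AbsLE O (1 - y * y) 1 := by
  rw [← mem_iff_absLE_one] at *
  rcases hO with ⟨i, j, rfl⟩ | ⟨A, hA, rfl⟩
  · constructor <;> nlinarith [hy.1, hy.2]
  · exact sub_mem A.one_mem (mul_mem hy hy)

/-- A field with absolute value `|·|` that is archimedean for `τ` has an element `σ ∈ {τ, τ⁻¹}`
of absolute value less than one. -/
theorem TauArchimedean.exists_absLT_one (hO : IsUnitBall O) {τ : K} (h : TauArchimedean O τ) : AbsLT O τ 1 ∨ AbsLT O τ⁻¹ 1 := by
  obtain ⟨Γ, _, φ, hφ⟩ := hO.exists_monoidWithZeroHom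
  have hlt : ∀ x y, AbsLT O x y ↔ φ x < φ y := fun x y => by rw [← not_absLE hO, hφ, not_le]
  obtain ⟨x, hx0, hx⟩ := exists_ne_zero_absLT_one hO
  simp only [hlt, map_one, map_inv₀] at hx ⊢
  rcases lt_trichotomy (φ τ) 1 with h1 | h1 | h1
  · exact Or.inl h1
  · obtain ⟨k, hk⟩ := h x hx0
    rw [hφ, map_zpow₀, h1, one_zpow] at hk
    exact absurd hx (not_lt.2 hk)
  · exact Or.inr (inv_lt_one_of_one_lt₀ h1)

end AbsoluteValue

/-! ### The ball topology -/

section BallTopology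

variable {K : Type w} [Field K] {O : Set K}

/-- The balls are given only as a subbasis. The order topology and the valuation topology, with
which the generated topology agrees, have the balls centered at a point as a basis there. -/
theorem exists_openBall_subset (hO : IsUnitBall O) {x : K} {s : Set K}
    (hs : s ∈ @nhds K (ballTopology O) x) : ∃ r, r ≠ 0 ∧ openBall O x r ⊆ s := by
  rcases hO with ⟨i, j, rfl⟩ | ⟨A, -, rfl⟩
  · rw [ballTopology_Icc] at hs
    let _ : TopologicalSpace K := Preorder.topology K
    have _ : OrderTopology K := ⟨rfl⟩
    obtain ⟨r, hr, h⟩ := (nhds_basis_abs_sub_lt x).mem_iff.1 hs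
    refine ⟨r, hr.ne', fun y hy => h ?_⟩
    simpa [openBall, AbsLT, absLE_Icc, abs_of_pos hr] using hy.2
  · rw [ballTopology_valuationSubring] at hs
    let vK := Valued.mk' A.valuation
    obtain ⟨γ, hγ⟩ := Valued.mem_nhds.1 hs
    obtain ⟨a, b, ha, hb', hab⟩ := Valuation.exists_div_eq_of_unit vK.v γ
    have ha0 : a ≠ 0 := by rintro rfl; simp at ha
    have hb0 : b ≠ 0 := by rintro rfl; simp at hb'
    refine ⟨a / b, div_ne_zero ha0 hb0, fun y hy => hγ ?_⟩
    simp only [openBall, AbsLT, absLE_valuationSubring, mem_ofPred_eq, not_le] at hy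
    rw [mem_ofPred_eq, ← hab, ← map_div₀]
    exact (Valuation.restrict_lt_iff _).2 hy.2

theorem isOpen_openBall {c r : K} (hr : r ≠ 0) : IsOpen[ballTopology O] (openBall O c r) :=
  TopologicalSpace.isOpen_generateFrom_of_mem ⟨c, r, hr, rfl⟩

theorem mem_openBall_self (hO : IsUnitBall O) {c r : K} (hr : r ≠ 0) : c ∈ openBall O c r := by
  rw [openBall, mem_ofPred_eq, sub_self]
  exact absLT_zero_left hO hr

theorem openBall_mem_nhds (hO : IsUnitBall O) {c r : K} (hr : r ≠ 0) :
    openBall O c r ∈ @nhds K (ballTopology O) c :=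
  letI := ballTopology O
  (isOpen_openBall hr).mem_nhds (mem_openBall_self hO hr)

theorem continuousInv₀_ballTopology (hO : IsUnitBall O) :
    @ContinuousInv₀ K _ _ (ballTopology O) := by
  rcases hO with ⟨i, j, rfl⟩ | ⟨A, -, rfl⟩
  · rw [ballTopology_Icc]
    let _ : TopologicalSpace K := Preorder.topology K
    have _ : OrderTopology K := ⟨rfl⟩
    infer_instance
  · rw [ballTopology_valuationSubring]
    let _ := Valued.mk' A.valuation
    infer_instance

theorem t1Space_ballTopology (hO : IsUnitBall O) : @T1Space K (ballTopology O) := by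
  let _ := ballTopology O
  refine ⟨fun x => ⟨?_⟩⟩
  refine isOpen_ballTopology fun y hy => ⟨x - y, sub_ne_zero.2 (Ne.symm hy),
    mem_openBall_self hO (sub_ne_zero.2 (Ne.symm hy)), ?_⟩
  rintro z hz rfl
  exact hz.2 (absLE_refl hO _)

/-- In the valued case, points `a'`, `b'` at distance less than `|b|` from `a`, `b` satisfy `|a'| <
|b| = |b'|` by the ultrametric inequality. -/
theorem isOpen_absLT (hO : IsUnitBall O) :
    letI := ballTopology O
    IsOpen {p : K × K | AbsLT O p.1 p.2} := by
  let _ := ballTopology O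
  rcases hO with ⟨i, j, rfl⟩ | ⟨A, hA, rfl⟩
  · have h : {p : K × K | AbsLT (Set.Icc (-1) 1) p.1 p.2} = {p : K × K | |p.1| < |p.2|} := by
      ext p
      simp only [AbsLT, absLE_Icc, mem_ofPred_eq, not_le]
      exact ⟨fun h => h.2, fun h => ⟨h.le, h⟩⟩
    rw [h]
    have h' : ballTopology (Set.Icc (-1 : K) 1) = Preorder.topology K := ballTopology_Icc
    revert h'
    generalize ballTopology (Set.Icc (-1 : K) 1) = T
    rintro rfl
    let _ : TopologicalSpace K := Preorder.topology K
    have _ : OrderTopology K := ⟨rfl⟩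
    exact isOpen_lt (by fun_prop) (by fun_prop)
  · have hO : IsUnitBall (A : Set K) := Or.inr ⟨A, hA, rfl⟩
    rw [isOpen_iff_mem_nhds]
    rintro ⟨a, b⟩ (hab : AbsLT _ a b)
    have hb := hab.ne_zero hO
    filter_upwards [prod_mem_nhds (openBall_mem_nhds hO (c := a) hb)
      (openBall_mem_nhds hO (c := b) hb)]
    rintro ⟨a', b'⟩ ⟨ha', hb'⟩
    simp only [openBall, AbsLT, absLE_valuationSubring, mem_ofPred_eq, not_le] at ha' hb' hab ⊢
    have h1 : A.valuation b' = A.valuation b := by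
      rw [← sub_add_cancel b' b]
      exact Valuation.map_add_eq_of_lt_right _ hb'.2
    have h2 : A.valuation a' < A.valuation b := by
      rw [← sub_add_cancel a' a]
      exact Valuation.map_add_lt _ ha'.2 hab.2
    rw [h1]
    exact ⟨h2.le, h2⟩

theorem isClosed_absLE (hO : IsUnitBall O) :
    letI := ballTopology O
    IsClosed {p : K × K | AbsLE O p.1 p.2} := by
  let _ := ballTopology O
  refine ⟨?_⟩
  have : {p : K × K | AbsLE O p.1 p.2}ᶜ = Prod.swap ⁻¹' {p : K × K | AbsLT O p.1 p.2} := by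
    ext p
    exact not_absLE hO
  rw [this]
  exact (isOpen_absLT hO).preimage continuous_swap

/-- On the frontier `|a| = |b|`. For an order this is `a² = b²`. For a valuation, absolute values
are locally constant away from zero, so the origin is the only possible frontier point. The equation
with squares covers both cases. -/
theorem sq_eq_sq_of_mem_frontier (hO : IsUnitBall O) {q : K × K}
    (hq : letI := ballTopology O; q ∈ frontier {p : K × K | AbsLE O p.2 p.1}) :
    q.1 ^ 2 = q.2 ^ 2 := by
  let _ := ballTopology O
  have hopen := isOpen_absLT hO
  have hclosed : IsClosed {p : K × K | AbsLE O p.2 p.1} :=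
    (isClosed_absLE hO).preimage continuous_swap
  have h1 : AbsLE O q.2 q.1 := hclosed.frontier_subset hq
  have hnot : {p : K × K | AbsLE O p.2 p.1} ∉ 𝓝 q := fun h =>
    hq.2 (mem_interior_iff_mem_nhds.2 h)
  have h2 : AbsLE O q.1 q.2 := by
    by_contra h
    rw [not_absLE hO] at h
    refine hnot (Filter.mem_of_superset ((hopen.preimage continuous_swap).mem_nhds h) ?_)
    exact fun p hp => hp.1
  rcases hO with ⟨i, j, rfl⟩ | ⟨A, hA, rfl⟩
  · rw [absLE_Icc] at h1 h2
    exact sq_eq_sq_iff_abs_eq_abs _ _ |>.2 (le_antisymm h2 h1)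
  · have hO : IsUnitBall (A : Set K) := Or.inr ⟨A, hA, rfl⟩
    by_contra hne
    rw [absLE_valuationSubring] at h1 h2
    have heq := le_antisymm h1 h2
    have h01 : q.1 ≠ 0 := by
      intro h0
      rw [h0, map_zero, map_eq_zero] at heq
      simp [h0, heq] at hne
    have h02 : q.2 ≠ 0 := by
      intro h0
      rw [h0, map_zero, eq_comm, map_eq_zero] at heq
      exact h01 heq
    refine hnot ?_
    filter_upwards [prod_mem_nhds (openBall_mem_nhds hO (c := q.1) h01)
      (openBall_mem_nhds hO (c := q.2) h02)]
    rintro ⟨a', b'⟩ ⟨ha', hb'⟩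
    simp only [openBall, AbsLT, absLE_valuationSubring, mem_ofPred_eq, not_le] at ha' hb' ⊢
    have h3 : A.valuation a' = A.valuation q.1 := by
      rw [← sub_add_cancel a' q.1]
      exact Valuation.map_add_eq_of_lt_right _ ha'.2
    have h4 : A.valuation b' = A.valuation q.2 := by
      rw [← sub_add_cancel b' q.2]
      exact Valuation.map_add_eq_of_lt_right _ hb'.2
    rw [h3, h4, heq]

theorem absLE_of_sq_eq_sq (hO : IsUnitBall O) {x y : K} (h : x ^ 2 = y ^ 2) : AbsLE O x y := by
  obtain ⟨Γ, _, φ, hφ⟩ := hO.exists_monoidWithZeroHom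
  rw [hφ]
  refine le_of_not_gt fun hlt => ?_
  have := congrArg φ h
  rw [map_pow, map_pow] at this
  exact (pow_lt_pow_left₀ hlt zero_le two_ne_zero).ne this.symm

open Classical in
/-- Functions defined by cases `|b| ≤ |a|` and `|a| < |b|` are continuous if the two definitions
agree where `a² = b²`. -/
theorem continuousAt_ite_absLE (hO : IsUnitBall O) {Y : Type*} [TopologicalSpace Y]
    {F G : K × K → Y} {q : K × K} (h : q.1 ^ 2 = q.2 ^ 2 → F q = G q)
    (hF : letI := ballTopology O; AbsLE O q.2 q.1 → ContinuousAt F q)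
    (hG : letI := ballTopology O; AbsLE O q.1 q.2 → ContinuousAt G q) :
    letI := ballTopology O
    ContinuousAt (fun p => if AbsLE O p.2 p.1 then F p else G p) q := by
  let _ := ballTopology O
  by_cases hq : q ∈ frontier {p : K × K | AbsLE O p.2 p.1}
  · have hsq := sq_eq_sq_of_mem_frontier hO hq
    have hle := absLE_of_sq_eq_sq hO hsq.symm
    have hval : (if AbsLE O q.2 q.1 then F q else G q) = F q := if_pos hle
    rw [ContinuousAt, hval]
    refine Filter.Tendsto.if' (hF hle) ?_
    rw [h hsq]
    exact hG (absLE_of_sq_eq_sq hO hsq)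
  · by_cases hq' : AbsLE O q.2 q.1
    · have : {p : K × K | AbsLE O p.2 p.1} ∈ 𝓝 q := by
        rw [← mem_interior_iff_mem_nhds]
        by_contra hi
        exact hq ⟨subset_closure hq', hi⟩
      refine (hF hq').congr ?_
      filter_upwards [this] with p hp
      exact (if_pos hp).symm
    · have : {p : K × K | AbsLE O p.2 p.1}ᶜ ∈ 𝓝 q := by
        rw [← mem_interior_iff_mem_nhds, interior_compl]
        exact fun hc => hq ⟨hc, fun hi => hq' <| by
          have := interior_subset hi
          exact this⟩
      refine (hG ((not_absLE hO).1 hq').1).congr ?_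
      filter_upwards [this] with p hp
      exact (if_neg hp).symm

end BallTopology

/-! ### Pairs of predicates in expansions of fields -/

section FieldPair

variable {L : FirstOrder.Language.{u, v}} {K : Type*} [Field K] [L.Structure K]
  {K' : Type*} [Field K'] [L.Structure K']
  {A : Type*} {α : Type*} {a : A → K} {b : A → K'}
  {s t : (α → K) → K} {s' t' : (α → K') → K'}

theorem FunPair.ringOp {ι : ringBall →ᴸ L} [IsFieldExpansion ι K] [IsFieldExpansion ι K']
    {n : ℕ} (F : ringFunc n) {t : Fin n → (α → K) → K}
    {t' : Fin n → (α → K') → K'} (ht : ∀ i, FunPair L a b (t i) (t' i)) :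
    FunPair L a b (fun v => ringOp F fun i => t i v) (fun v => ringOp F fun i => t' i v) := by
  have h := (FunPair.funMap (a := a) (b := b) (ι.onFunction F)).comp ht
  simpa only [IsFieldExpansion.funMap_eq] using h

theorem FunPair.add {ι : ringBall →ᴸ L} [IsFieldExpansion ι K] [IsFieldExpansion ι K']
    (hs : FunPair L a b s s') (ht : FunPair L a b t t') :
    FunPair L a b (fun v => s v + t v) (fun v => s' v + t' v) :=
  FunPair.ringOp (ι := ι) .add (t := ![s, t]) (t' := ![s', t']) (Fin.forall_fin_two.2 ⟨hs, ht⟩)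

theorem FunPair.mul {ι : ringBall →ᴸ L} [IsFieldExpansion ι K] [IsFieldExpansion ι K']
    (hs : FunPair L a b s s') (ht : FunPair L a b t t') :
    FunPair L a b (fun v => s v * t v) (fun v => s' v * t' v) :=
  FunPair.ringOp (ι := ι) .mul (t := ![s, t]) (t' := ![s', t']) (Fin.forall_fin_two.2 ⟨hs, ht⟩)

theorem FunPair.neg {ι : ringBall →ᴸ L} [IsFieldExpansion ι K] [IsFieldExpansion ι K']
    (hs : FunPair L a b s s') :
    FunPair L a b (fun v => - s v) (fun v => - s' v) :=
  FunPair.ringOp (ι := ι) .neg (t := ![s]) (t' := ![s']) (Fin.forall_fin_one.2 hs)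

theorem FunPair.zero {ι : ringBall →ᴸ L} [IsFieldExpansion ι K] [IsFieldExpansion ι K']
    :
    FunPair L a b (fun _ : α → K => 0) (fun _ : α → K' => 0) :=
  FunPair.ringOp (ι := ι) .zero (t := ![]) (t' := ![]) (fun i => i.elim0)

theorem FunPair.one {ι : ringBall →ᴸ L} [IsFieldExpansion ι K] [IsFieldExpansion ι K']
    :
    FunPair L a b (fun _ : α → K => 1) (fun _ : α → K' => 1) :=
  FunPair.ringOp (ι := ι) .one (t := ![]) (t' := ![]) (fun i => i.elim0)

theorem FunPair.sub {ι : ringBall →ᴸ L} [IsFieldExpansion ι K] [IsFieldExpansion ι K']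
    (hs : FunPair L a b s s') (ht : FunPair L a b t t') :
    FunPair L a b (fun v => s v - t v) (fun v => s' v - t' v) := by
  simp only [sub_eq_add_neg]
  exact hs.add (ι := ι) (ht.neg (ι := ι))

/-- The graph of the inverse is given by `s = 0 ∧ y = 0` or `s * y = 1`; the first case is the
convention `0⁻¹ = 0`. -/
theorem FunPair.inv {ι : ringBall →ᴸ L} [IsFieldExpansion ι K] [IsFieldExpansion ι K']
    (hs : FunPair L a b s s') :
    FunPair L a b (fun v => (s v)⁻¹) (fun v => (s' v)⁻¹) := by
  have hvar := FunPair.var (L := L) (a := a) (b := b) (Sum.inr () : α ⊕ Unit)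
  have h := ((hs.relabel (Sum.inl (β := Unit))).eq (.zero (ι := ι))).and (hvar.eq (.zero (ι := ι)))
  have h' := ((hs.relabel (Sum.inl (β := Unit))).mul (ι := ι) hvar).eq (.one (ι := ι))
  refine (h.or h').congr (fun v => ?_) (fun v => ?_)
  · by_cases hz : s (fun i => v (Sum.inl i)) = 0
    · simp [hz, eq_comm]
    · simp only [hz, false_and, false_or]
      exact ⟨fun h => by rw [← h, mul_inv_cancel₀ hz], fun h => (eq_inv_of_mul_eq_one_right h).symm⟩
  · by_cases hz : s' (fun i => v (Sum.inl i)) = 0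
    · simp [hz, eq_comm]
    · simp only [hz, false_and, false_or]
      exact ⟨fun h => by rw [← h, mul_inv_cancel₀ hz], fun h => (eq_inv_of_mul_eq_one_right h).symm⟩

theorem DefPair.mem_unitBall {ι : ringBall →ᴸ L} [IsFieldExpansion ι K] [IsFieldExpansion ι K']
    (hs : FunPair L a b s s') :
    DefPair L a b (fun v => s v ∈ unitBall ι K) (fun v => s' v ∈ unitBall ι K') := by
  have h := (DefPair.rel (a := a) (b := b) (ι.onRelation BallRel.ball)).comp
    (t := ![s]) (t' := ![s']) (Fin.forall_fin_one.2 hs)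
  refine h.congr (fun v => ?_) (fun v => ?_) <;>
  · refine iff_of_eq (congrArg (Structure.RelMap (ι.onRelation BallRel.ball)) ?_)
    ext i
    rw [Subsingleton.elim i 0]
    rfl

theorem DefPair.absLE {ι : ringBall →ᴸ L} [IsFieldExpansion ι K] [IsFieldExpansion ι K']
    (hs : FunPair L a b s s') (ht : FunPair L a b t t') :
    DefPair L a b (fun v => AbsLE (unitBall ι K) (s v) (t v))
      (fun v => AbsLE (unitBall ι K') (s' v) (t' v)) :=
  .ex (.and (.mem_unitBall (.var _)) ((hs.relabel _).eq ((ht.relabel _).mul (ι := ι) (.var _))))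

theorem DefPair.absLT {ι : ringBall →ᴸ L} [IsFieldExpansion ι K] [IsFieldExpansion ι K']
    (hs : FunPair L a b s s') (ht : FunPair L a b t t') :
    DefPair L a b (fun v => AbsLT (unitBall ι K) (s v) (t v))
      (fun v => AbsLT (unitBall ι K') (s' v) (t' v)) :=
  (DefPair.absLE hs ht).and (DefPair.absLE ht hs).not

end FieldPair

/-! ### Membership in graphs of functions -/

section Graph

variable {L : FirstOrder.Language.{u, v}} {K : Type*} [L.Structure K]
  {K' : Type*} [L.Structure K'] {A : Type*} {α : Type*} {a : A → K} {b : A → K'} {m : ℕ}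

theorem snoc_mem_graph {X : Set (Fin m → K)} {f : X → K} {x : Fin m → K} {y : K} :
    (Fin.snoc x y : Fin (m + 1) → K) ∈ graph f ↔ ∃ h : x ∈ X, f ⟨x, h⟩ = y := by
  simp only [graph, mem_ofPred_eq, Fin.init_snoc, Fin.snoc_last]

theorem snoc_mem_graph_iff {X : Set (Fin m → K)} {f : X → K} (x : X) {y : K} :
    (Fin.snoc x.1 y : Fin (m + 1) → K) ∈ graph f ↔ f x = y := by
  rw [snoc_mem_graph]
  exact ⟨fun ⟨_, h⟩ => h, fun h => ⟨x.2, h⟩⟩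

theorem DefPair.snoc_mem {G : Set (Fin (m + 1) → K)} {G' : Set (Fin (m + 1) → K')}
    (h : DefPair L a b (· ∈ G) (· ∈ G')) {x : Fin m → (α → K) → K} {x' : Fin m → (α → K') → K'}
    {y : (α → K) → K} {y' : (α → K') → K'} (hx : ∀ i, FunPair L a b (x i) (x' i))
    (hy : FunPair L a b y y') :
    DefPair L a b (fun v => (Fin.snoc (fun i => x i v) (y v) : Fin (m + 1) → K) ∈ G)
      (fun v => (Fin.snoc (fun i => x' i v) (y' v) : Fin (m + 1) → K') ∈ G') := by
  have h' : ∀ i, FunPair L a b ((Fin.snoc x y : Fin (m + 1) → (α → K) → K) i)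
      ((Fin.snoc x' y' : Fin (m + 1) → (α → K') → K') i) := by
    intro i
    refine Fin.lastCases ?_ (fun i => ?_) i
    · simpa using hy
    · simpa using hx i
  refine (DefPair.comp h h').congr (fun v => ?_) (fun v => ?_) <;>
  · refine iff_of_eq (congrArg (· ∈ _) ?_)
    ext i
    refine Fin.lastCases ?_ (fun i => ?_) i <;> simp

theorem mem_graph_iff {X : Set (Fin m → K)} {f : X → K} {z : Fin (m + 1) → K} :
    z ∈ graph f ↔ ∃ h : (fun i => z (Fin.castSucc i)) ∈ X, f ⟨_, h⟩ = z (Fin.last m) := Iff.rfl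

end Graph

/-! ### Constructions of continuous definable functions -/

section Constructions

variable {L : FirstOrder.Language.{u, v}} {ι : ringBall →ᴸ L}
  {K : Type w} [Field K] [L.Structure K] {m : ℕ}

theorem isDefCont_comp₂ {X : Set (Fin m → K)} {Φ : K × K → K}
    (hΦ : FunPair L (id : K → K) (id : K → K) (fun v : Fin 2 → K => Φ (v 0, v 1))
      (fun v : Fin 2 → K => Φ (v 0, v 1)))
    {f g : X → K} (hf : IsDefCont ι f) (hg : IsDefCont ι g)
    (hc : letI := ballTopology (unitBall ι K); ∀ x, ContinuousAt Φ (f x, g x)) :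
    IsDefCont ι fun x => Φ (f x, g x) := by
  let _ := ballTopology (unitBall ι K)
  refine ⟨continuous_iff_continuousAt.2 fun x => ContinuousAt.comp
    (g := Φ) (f := fun x => (f x, g x)) (hc x) (hf.1.prodMk hg.1).continuousAt, ?_⟩
  have hf' := definable_iff_defPair.1 hf.2
  have hg' := definable_iff_defPair.1 hg.2
  rw [definable_iff_defPair]
  let Q : (Fin (m + 1) → K) → Prop := fun z => ∃ a b,
    (Fin.snoc (fun i => z (Fin.castSucc i)) a : Fin (m + 1) → K) ∈ graph f ∧
    (Fin.snoc (fun i => z (Fin.castSucc i)) b : Fin (m + 1) → K) ∈ graph g ∧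
    Φ (a, b) = z (Fin.last m)
  have h : DefPair L (id : K → K) (id : K → K) Q Q :=
    .ex (.ex (.and (hf'.snoc_mem (fun i => .var _) (.var _))
      (.and (hg'.snoc_mem (fun i => .var _) (.var _))
        ((FunPair.comp₂ (F := fun a b => Φ (a, b)) (F' := fun a b => Φ (a, b)) hΦ
          (.var _) (.var _)).eq (.var _)))))
  have key : ∀ z, z ∈ graph (fun x => Φ (f x, g x)) ↔ Q z := by
    intro z
    simp only [Q, snoc_mem_graph]
    rw [mem_graph_iff]
    constructor
    · rintro ⟨h, hz⟩
      exact ⟨_, _, ⟨h, rfl⟩, ⟨h, rfl⟩, hz⟩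
    · rintro ⟨_, _, ⟨h, rfl⟩, ⟨_, rfl⟩, hz⟩
      exact ⟨h, hz⟩
  exact h.congr key key

variable (X : L.DefinableSet (Set.univ : Set K) (Fin m))

theorem isDefCont_const (c : K) : IsDefCont ι fun _ : (X : Set (Fin m → K)) => c := by
  let _ := ballTopology (unitBall ι K)
  refine ⟨continuous_const, definable_iff_defPair.2 ?_⟩
  have hX := definable_iff_defPair.1 X.2
  have h := (hX.relabel Fin.castSucc).and ((FunPair.const c).eq (.var (Fin.last m)))
  refine h.congr (fun z => ?_) (fun z => ?_) <;>
  exact mem_graph_iff.trans exists_prop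

theorem isDefCont_coord (i : Fin m) : IsDefCont ι fun x : (X : Set (Fin m → K)) => x.1 i := by
  let _ := ballTopology (unitBall ι K)
  refine ⟨(continuous_apply i).comp continuous_subtype_val, definable_iff_defPair.2 ?_⟩
  have hX := definable_iff_defPair.1 X.2
  have h := (hX.relabel Fin.castSucc).and
    (FunPair.eq (.var (Fin.castSucc i)) (.var (Fin.last m)))
  refine h.congr (fun z => ?_) (fun z => ?_) <;>
  exact ⟨fun ⟨h1, h2⟩ => ⟨h1, h2⟩, fun ⟨h1, h2⟩ => ⟨h1, h2⟩⟩

variable [IsFieldExpansion ι K]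

variable (ι K) in
theorem isUnitBall_unitBall : IsUnitBall (unitBall ι K) := IsFieldExpansion.isUnitBall

/-- A constant function, as an element of `𝒞(X)`. -/
def constC (c : K) : C ι X := ⟨fun _ => c, isDefCont_const X c⟩

/-- A coordinate function, as an element of `𝒞(X)`. -/
def coordC (i : Fin m) : C ι X := ⟨fun x => x.1 i, isDefCont_coord X i⟩

variable {X}

open Classical in
theorem isDefCont_ite_absLE {F G : K → K → K}
    (hF : FunPair L (id : K → K) (id : K → K) (fun v : Fin 2 → K => F (v 0) (v 1))
      (fun v : Fin 2 → K => F (v 0) (v 1)))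
    (hG : FunPair L (id : K → K) (id : K → K) (fun v : Fin 2 → K => G (v 0) (v 1))
      (fun v : Fin 2 → K => G (v 0) (v 1)))
    (f g : C ι X) (heq : ∀ x, f.1 x ^ 2 = g.1 x ^ 2 → F (f.1 x) (g.1 x) = G (f.1 x) (g.1 x))
    (hFc : letI := ballTopology (unitBall ι K); ∀ x, AbsLE (unitBall ι K) (g.1 x) (f.1 x) →
      ContinuousAt (fun p : K × K => F p.1 p.2) (f.1 x, g.1 x))
    (hGc : letI := ballTopology (unitBall ι K); ∀ x, AbsLE (unitBall ι K) (f.1 x) (g.1 x) →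
      ContinuousAt (fun p : K × K => G p.1 p.2) (f.1 x, g.1 x)) :
    IsDefCont ι fun x => if AbsLE (unitBall ι K) (g.1 x) (f.1 x) then F (f.1 x) (g.1 x)
      else G (f.1 x) (g.1 x) :=
  letI := ballTopology (unitBall ι K)
  isDefCont_comp₂
    (Φ := fun p => if AbsLE (unitBall ι K) p.2 p.1 then F p.1 p.2 else G p.1 p.2)
    (.ite (.absLE (.var 1) (.var 0)) hF hG) f.2 g.2 fun x =>
    continuousAt_ite_absLE (isUnitBall_unitBall ι K) (F := fun p => F p.1 p.2)
      (G := fun p => G p.1 p.2) (heq x) (hFc x) (hGc x)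

/-- Two functions without common zeros generate the unit ideal. -/
theorem exists_mul_add_mul_eq_one (f g : C ι X) (h : ∀ x, ¬ (f.1 x = 0 ∧ g.1 x = 0)) :
    ∃ p q : C ι X, p * f + q * g = 1 := by
  classical
  have hO := isUnitBall_unitBall ι K
  let _ := ballTopology (unitBall ι K)
  have _ := isTopologicalRing_ballTopology hO
  have _ := continuousInv₀_ballTopology hO
  have hf : ∀ x, AbsLE (unitBall ι K) (g.1 x) (f.1 x) → f.1 x ≠ 0 := fun x hx h0 =>
    h x ⟨h0, by rwa [h0, absLE_zero_iff hO] at hx⟩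
  have hg : ∀ x, AbsLE (unitBall ι K) (f.1 x) (g.1 x) → g.1 x ≠ 0 := fun x hx h0 =>
    h x ⟨by rwa [h0, absLE_zero_iff hO] at hx, h0⟩
  have v0 : FunPair L (id : K → K) (id : K → K) (fun v : Fin 2 → K => v 0) fun v => v 0 := .var _
  have v1 : FunPair L (id : K → K) (id : K → K) (fun v : Fin 2 → K => v 1) fun v => v 1 := .var _
  -- For `|b| ≤ |a|` the coefficients are `(a² - b²)/a³` and `b/a²`, otherwise `0` and `1/b`; they
  -- agree where `a² = b²`. The choice `a/(a² + b²)`, `b/(a² + b²)` is not available, since `a² +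
  -- b²` may vanish in a valued field.
  have hp := isDefCont_ite_absLE (F := fun a b => (a * a - b * b) * (a * a * a)⁻¹)
    (G := fun _ _ => 0)
    (((v0.mul v0 (ι := ι)).sub (v1.mul v1 (ι := ι)) (ι := ι)).mul
      (((v0.mul v0 (ι := ι)).mul v0 (ι := ι)).inv (ι := ι)) (ι := ι)) (.zero (ι := ι)) f g
    (fun x hx => by rw [sq, sq] at hx; simp [hx])
    (fun x hx => by
      have h0 : f.1 x * f.1 x * f.1 x ≠ 0 := by simp [hf x hx]
      exact ContinuousAt.mul (by fun_prop) (ContinuousAt.inv₀ (by fun_prop) h0))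
    (fun x hx => continuousAt_const)
  have hq := isDefCont_ite_absLE (F := fun a b => b * (a * a)⁻¹) (G := fun _ b => b⁻¹)
    (v1.mul ((v0.mul v0 (ι := ι)).inv (ι := ι)) (ι := ι)) (v1.inv (ι := ι)) f g
    (fun x hx => by
      have h0 := hg x (absLE_of_sq_eq_sq hO hx)
      rw [sq, sq] at hx
      rw [hx]
      field_simp)
    (fun x hx => by
      have h0 : f.1 x * f.1 x ≠ 0 := by simp [hf x hx]
      exact ContinuousAt.mul (by fun_prop) (ContinuousAt.inv₀ (by fun_prop) h0))
    (fun x hx => ContinuousAt.inv₀ (by fun_prop) (hg x hx))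
  refine ⟨⟨_, hp⟩, ⟨_, hq⟩, Subtype.ext (funext fun x => ?_)⟩
  change (if _ then _ else _) * f.1 x + (if _ then _ else _) * g.1 x = 1
  split_ifs with hx
  · have := hf x hx
    field_simp
    ring
  · have := hg x ((not_absLE hO).1 hx).1
    field_simp
    ring

/-- A function with the zeros of `f`, and of absolute value at most `|f|` and at most one. -/
theorem exists_absLE_one (f : C ι X) : ∃ g : C ι X, (∀ x, g.1 x = 0 ↔ f.1 x = 0) ∧
    (∀ x, AbsLE (unitBall ι K) (g.1 x) (f.1 x)) ∧ ∀ x, AbsLE (unitBall ι K) (g.1 x) 1 := by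
  classical
  have hO := isUnitBall_unitBall ι K
  let _ := ballTopology (unitBall ι K)
  have _ := isTopologicalRing_ballTopology hO
  have v1 : FunPair L (id : K → K) (id : K → K) (fun v : Fin 2 → K => v 1) fun v => v 1 := .var _
  -- The function is `f²` where `|f| ≤ 1` and `1` elsewhere; the constant `1` serves as the first
  -- argument of the comparison.
  have hg := isDefCont_ite_absLE (F := fun a b => b * b) (G := fun _ _ => 1)
    (v1.mul v1 (ι := ι)) (.one (ι := ι)) (constC X 1) f
    (fun x hx => by
      rw [sq, sq] at hx
      exact hx.symm.trans (one_mul 1))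
    (fun x hx => by fun_prop) (fun x hx => by fun_prop)
  have key : ∀ x, ((if AbsLE (unitBall ι K) (f.1 x) 1 then f.1 x * f.1 x else 1) = 0 ↔ f.1 x = 0) ∧
      AbsLE (unitBall ι K) (if AbsLE (unitBall ι K) (f.1 x) 1 then f.1 x * f.1 x else 1) (f.1 x) ∧
      AbsLE (unitBall ι K) (if AbsLE (unitBall ι K) (f.1 x) 1 then f.1 x * f.1 x else 1) 1 := by
    intro x
    split_ifs with hx
    · refine ⟨mul_self_eq_zero, ?_, ?_⟩
      · simpa using absLE_mul hO (absLE_refl hO (f.1 x)) hx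
      · simpa using absLE_mul hO hx hx
    · have h1 := (not_absLE hO).1 hx
      exact ⟨iff_of_false one_ne_zero (h1.ne_zero hO), h1.1, absLE_refl hO _⟩
  exact ⟨⟨_, hg⟩, fun x => (key x).1, fun x => (key x).2.1, fun x => (key x).2.2⟩

/-- Take the square of whichever of `f`, `g` has the larger absolute value. Squaring makes the two
branches agree on the frontier; a plain sum of squares could have further zeros in a valued field.
-/
theorem exists_zero_iff_and (f g : C ι X) :
    ∃ h : C ι X, ∀ x, h.1 x = 0 ↔ f.1 x = 0 ∧ g.1 x = 0 := by
  classical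
  have hO := isUnitBall_unitBall ι K
  let _ := ballTopology (unitBall ι K)
  have _ := isTopologicalRing_ballTopology hO
  have v0 : FunPair L (id : K → K) (id : K → K) (fun v : Fin 2 → K => v 0) fun v => v 0 := .var _
  have v1 : FunPair L (id : K → K) (id : K → K) (fun v : Fin 2 → K => v 1) fun v => v 1 := .var _
  have hg := isDefCont_ite_absLE (F := fun a _ => a * a) (G := fun _ b => b * b)
    (v0.mul v0 (ι := ι)) (v1.mul v1 (ι := ι)) f g (fun x hx => by rwa [sq, sq] at hx)
    (fun x hx => by fun_prop) (fun x hx => by fun_prop)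
  have key : ∀ x, (if AbsLE (unitBall ι K) (g.1 x) (f.1 x) then f.1 x * f.1 x
      else g.1 x * g.1 x) = 0 ↔ f.1 x = 0 ∧ g.1 x = 0 := by
    intro x
    split_ifs with hx
    · rw [mul_self_eq_zero, iff_self_and]
      intro h
      rwa [h, absLE_zero_iff hO] at hx
    · have h1 := ((not_absLE hO).1 hx).ne_zero hO
      simp [h1]
  exact ⟨⟨_, hg⟩, key⟩

theorem exists_zero_iff_eq (p : (X : Set (Fin m → K))) :
    ∃ h : C ι X, ∀ x, h.1 x = 0 ↔ x = p := by
  classical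
  have key : ∀ s : Finset (Fin m), ∃ h : C ι X, ∀ x, h.1 x = 0 ↔ ∀ i ∈ s, x.1 i = p.1 i := by
    intro s
    induction s using Finset.induction_on with
    | empty => exact ⟨0, fun x => by simp⟩
    | insert i s _ ih =>
      obtain ⟨h, hh⟩ := ih
      obtain ⟨g, hg⟩ := exists_zero_iff_and (coordC X i - constC X (p.1 i)) h
      refine ⟨g, fun x => ?_⟩
      rw [hg, hh, Finset.forall_mem_insert]
      exact and_congr_left' sub_eq_zero
  obtain ⟨h, hh⟩ := key Finset.univ
  refine ⟨h, fun x => ?_⟩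
  rw [hh, Subtype.ext_iff, funext_iff]
  simp

/-- Take `1 - f²` where `|f| ≤ 1` and `0` elsewhere; the branches agree where `f² = 1`. -/
theorem exists_bump (f : C ι X) : ∃ t : C ι X, (∀ x, f.1 x = 0 → t.1 x = 1) ∧
    (∀ x, AbsLE (unitBall ι K) (t.1 x) 1) ∧ ∀ x, t.1 x ≠ 0 → AbsLE (unitBall ι K) (f.1 x) 1 := by
  classical
  have hO := isUnitBall_unitBall ι K
  let _ := ballTopology (unitBall ι K)
  have _ := isTopologicalRing_ballTopology hO
  have v1 : FunPair L (id : K → K) (id : K → K) (fun v : Fin 2 → K => v 1) fun v => v 1 := .var _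
  have hg := isDefCont_ite_absLE (F := fun _ b => 1 - b * b) (G := fun _ _ => 0)
    ((FunPair.one (ι := ι)).sub (v1.mul v1 (ι := ι)) (ι := ι)) (.zero (ι := ι)) (constC X 1) f
    (fun x hx => by
      rw [sq, sq] at hx
      exact sub_eq_zero.2 ((one_mul 1).symm.trans hx))
    (fun x hx => by fun_prop) (fun x hx => by fun_prop)
  have key : ∀ x, (f.1 x = 0 →
      (if AbsLE (unitBall ι K) (f.1 x) 1 then 1 - f.1 x * f.1 x else 0) = 1) ∧
      AbsLE (unitBall ι K) (if AbsLE (unitBall ι K) (f.1 x) 1 then 1 - f.1 x * f.1 x else 0) 1 ∧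
      ((if AbsLE (unitBall ι K) (f.1 x) 1 then 1 - f.1 x * f.1 x else 0) ≠ 0 →
        AbsLE (unitBall ι K) (f.1 x) 1) := by
    intro x
    split_ifs with hx
    · exact ⟨fun h => by simp [h], one_sub_mul_self_mem hO hx, fun _ => hx⟩
    · refine ⟨fun h => absurd (h ▸ absLE_zero hO 1) hx, absLE_zero hO _, fun h => absurd rfl h⟩
  exact ⟨⟨_, hg⟩, fun x => (key x).1, fun x => (key x).2.1, fun x => (key x).2.2⟩

theorem prod_apply {κ : Type*} (s : Finset κ) (f : κ → C ι X) (x : (X : Set (Fin m → K))) :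
    (∏ i ∈ s, f i).1 x = ∏ i ∈ s, (f i).1 x := by
  rw [← Subring.subtype_apply, map_prod, Finset.prod_apply]
  rfl

theorem sum_apply {κ : Type*} (s : Finset κ) (f : κ → C ι X) (x : (X : Set (Fin m → K))) :
    (∑ i ∈ s, f i).1 x = ∑ i ∈ s, (f i).1 x := by
  rw [← Subring.subtype_apply, map_sum, Finset.sum_apply]
  rfl

theorem absLE_prod_one {O : Set K} (hO : IsUnitBall O) {κ : Type*} (s : Finset κ) (f : κ → K)
    (h : ∀ i ∈ s, AbsLE O (f i) 1) : AbsLE O (∏ i ∈ s, f i) 1 := by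
  classical
  induction s using Finset.induction_on with
  | empty => simpa using absLE_refl hO 1
  | insert i s hi ih =>
    rw [Finset.prod_insert hi]
    simpa using absLE_mul hO (h i (by simp)) (ih fun k hk => h k (by simp [hk]))

/-- A function with value one at `p` and support in the ball of radius `r` around `p`. -/
theorem exists_bump_ball (p : (X : Set (Fin m → K))) {r : K} (hr : r ≠ 0) :
    ∃ t : C ι X, t.1 p = 1 ∧ (∀ x, AbsLE (unitBall ι K) (t.1 x) 1) ∧
      ∀ x, t.1 x ≠ 0 → ∀ i, AbsLE (unitBall ι K) (x.1 i - p.1 i) r := by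
  have hO := isUnitBall_unitBall ι K
  choose t h1 h2 h3 using fun i => exists_bump (ι := ι) (X := X)
    ((coordC X i - constC X (p.1 i)) * constC X r⁻¹)
  refine ⟨∏ i, t i, ?_, fun x => ?_, fun x hx i => ?_⟩
  · rw [prod_apply]
    exact Finset.prod_eq_one fun i _ => h1 i p (show (p.1 i - p.1 i) * r⁻¹ = 0 by simp)
  · rw [prod_apply]
    exact absLE_prod_one hO _ _ fun i _ => h2 i x
  · rw [prod_apply, Finset.prod_ne_zero_iff] at hx
    have := h3 i x (hx i (Finset.mem_univ i))
    change AbsLE _ ((x.1 i - p.1 i) * r⁻¹) 1 at this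
    rwa [← absLE_mul_right_iff hO hr, inv_mul_cancel_right₀ hr, one_mul] at this

variable (ι) in
theorem exists_ball_subset {S : Set (Fin m → K)} (p : S) {A : Set S}
    (hA : letI := ballTopology (unitBall ι K); A ∈ 𝓝 p) :
    ∃ r : K, r ≠ 0 ∧ ∀ x : S, (∀ i, AbsLT (unitBall ι K) (x.1 i - p.1 i) r) → x ∈ A := by
  have hO := isUnitBall_unitBall ι K
  let _ := ballTopology (unitBall ι K)
  obtain ⟨u, hu, huA⟩ := mem_nhds_subtype _ _ _ |>.1 hA
  rw [nhds_pi, Filter.mem_pi'] at hu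
  obtain ⟨I, t, ht, htu⟩ := hu
  choose r hr hrt using fun i => exists_openBall_subset hO (ht i)
  obtain ⟨d, hd, hdr⟩ := exists_absLE_of_finite hO hr
  exact ⟨d, hd, fun x hx => huA (htu fun i _ => hrt i ((hx i).trans_absLE hO (hdr i)))⟩

variable (ι) in
theorem ball_mem_nhds {S : Set (Fin m → K)} (p : S) {r : K} (hr : r ≠ 0) :
    letI := ballTopology (unitBall ι K)
    {x : S | ∀ i, AbsLT (unitBall ι K) (x.1 i - p.1 i) r} ∈ 𝓝 p := by
  have hO := isUnitBall_unitBall ι K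
  let _ := ballTopology (unitBall ι K)
  rw [ofPred_forall, Filter.iInter_mem]
  intro i
  have hc : Continuous fun x : S => x.1 i := (continuous_apply i).comp continuous_subtype_val
  exact hc.continuousAt.preimage_mem_nhds (openBall_mem_nhds hO hr)

/-- The closed set `F` ensures that `t` vanishes near every point outside `F`, while `A` is a
neighborhood of every point of `F`. This is what extension by zero of a product with `t` needs. -/
theorem exists_bump_nhds (p : (X : Set (Fin m → K))) {A : Set (X : Set (Fin m → K))}
    (hA : letI := ballTopology (unitBall ι K); A ∈ 𝓝 p) :
    letI := ballTopology (unitBall ι K)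
    ∃ t : C ι X, t.1 p = 1 ∧ (∀ x, AbsLE (unitBall ι K) (t.1 x) 1) ∧
      ∃ F : Set (X : Set (Fin m → K)), IsClosed F ∧ F ⊆ interior A ∧ ∀ x, t.1 x ≠ 0 → x ∈ F := by
  have hO := isUnitBall_unitBall ι K
  let _ := ballTopology (unitBall ι K)
  have _ := isTopologicalRing_ballTopology hO
  obtain ⟨r, hr, h⟩ := exists_ball_subset ι p (interior_mem_nhds.2 hA)
  -- Since `|d| < 1`, the closed ball of radius `d * r` lies in the open ball of radius `r`.
  obtain ⟨d, hd, hd1⟩ := exists_ne_zero_absLT_one hO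
  obtain ⟨t, h1, h2, h3⟩ := exists_bump_ball (ι := ι) p (mul_ne_zero hd hr)
  refine ⟨t, h1, h2, {x | ∀ i, AbsLE (unitBall ι K) (x.1 i - p.1 i) (d * r)}, ?_, ?_, h3⟩
  · rw [ofPred_forall]
    refine isClosed_iInter fun i => ?_
    have hc : Continuous fun x : (X : Set (Fin m → K)) => (x.1 i - p.1 i, d * r) := by
      have : Continuous fun x : (X : Set (Fin m → K)) => x.1 i :=
        (continuous_apply i).comp continuous_subtype_val
      exact (this.sub continuous_const).prodMk continuous_const
    exact (isClosed_absLE hO).preimage hc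
  · refine fun x hx => h x fun i => ?_
    exact (hx i).trans_absLT hO (absLT_mul_of_absLT_one hO hd1 hr)

end Constructions

/-! ### Extension by zero -/

section Extension

variable {L : FirstOrder.Language.{u, v}} {ι : ringBall →ᴸ L}
  {K : Type w} [Field K] [L.Structure K] [IsFieldExpansion ι K] {m : ℕ}
  {X : L.DefinableSet (Set.univ : Set K) (Fin m)}

/-- The product of a function on `X` and a function on a subset `V`, extended by zero to `X`,
is continuous and definable if each point has a neighborhood in `V`, or a neighborhood on which
the first factor vanishes, or is a zero of the first factor while the second factor is bounded. -/
theorem exists_extend {V : Set (Fin m → K)} (hV : (Set.univ : Set K).Definable L V)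
    (w : C ι X) (f : V → K) (hf : IsDefCont ι f)
    (h : letI := ballTopology (unitBall ι K)
      ∀ x : (X : Set (Fin m → K)), {y : (X : Set (Fin m → K)) | y.1 ∈ V} ∈ 𝓝 x ∨
        (∀ᶠ y in 𝓝 x, w.1 y = 0) ∨ (w.1 x = 0 ∧ IsBddSet (unitBall ι K) (Set.range f))) :
    ∃ g : C ι X, (∀ x (hx : x.1 ∈ V), g.1 x = w.1 x * f ⟨x.1, hx⟩) ∧
      ∀ x, x.1 ∉ V → g.1 x = 0 := by
  classical
  have hO := isUnitBall_unitBall ι K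
  let _ := ballTopology (unitBall ι K)
  have _ := isTopologicalRing_ballTopology hO
  let F : (Fin m → K) → K := fun x => if hx : x ∈ V then f ⟨x, hx⟩ else 0
  have hF : ∀ x (hx : x ∈ V), F x = f ⟨x, hx⟩ := fun x hx => dif_pos hx
  have hF0 : ∀ x, x ∉ V → F x = 0 := fun x hx => dif_neg hx
  have hFc : ContinuousOn F V := by
    rw [continuousOn_iff_continuous_domRestrict]
    convert hf.1 using 1
    ext x
    exact hF x.1 x.2
  refine ⟨⟨fun x => w.1 x * F x.1, ?_, definable_iff_defPair.2 ?_⟩, fun x hx => ?_, fun x hx => ?_⟩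
  · refine continuous_iff_continuousAt.2 fun x => ?_
    rcases h x with h | h | ⟨h, r, hr⟩
    · have hxV : x.1 ∈ V := by
        have := mem_of_mem_nhds h
        exact this
      have h1 : ContinuousWithinAt (fun y : (X : Set (Fin m → K)) => F y.1)
          {y : (X : Set (Fin m → K)) | y.1 ∈ V} x :=
        ContinuousWithinAt.comp (hFc x.1 hxV) continuous_subtype_val.continuousWithinAt
          fun y hy => hy
      exact w.2.1.continuousAt.mul (h1.continuousAt h)
    · refine (continuousAt_const (y := (0 : K))).congr ?_
      filter_upwards [h] with y hy
      rw [hy, zero_mul]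
    · have hb : ∀ y, AbsLE (unitBall ι K) (F y) r := by
        intro y
        by_cases hy : y ∈ V
        · rw [hF y hy]
          exact hr _ ⟨_, rfl⟩
        · rw [hF0 y hy]
          exact absLE_zero hO r
      have hwr : Filter.Tendsto (fun y => w.1 y * r) (𝓝 x) (𝓝 0) := by
        have h1 : ContinuousAt (fun y => w.1 y * r) x := w.2.1.continuousAt.mul continuousAt_const
        rwa [ContinuousAt, h, zero_mul] at h1
      rw [ContinuousAt, h, zero_mul]
      intro s hs
      obtain ⟨ε, hε, hs⟩ := exists_openBall_subset hO hs
      have hw := hwr.eventually_mem (openBall_mem_nhds hO hε)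
      change ∀ᶠ y in 𝓝 x, w.1 y * F y.1 ∈ s
      filter_upwards [hw] with y hy
      refine hs ?_
      rw [openBall, mem_ofPred_eq, sub_zero] at hy
      rw [openBall, mem_ofPred_eq, sub_zero, ← not_absLE hO]
      rw [← not_absLE hO] at hy
      -- Here `|w F| ≤ |w r| < |ε|`: the first factor tends to zero and the second is bounded by
      -- `r`.
      exact fun hle => hy (absLE_trans hO hle (absLE_mul hO (absLE_refl hO _) (hb _)))
  · have hX := definable_iff_defPair.1 X.2
    have hV := definable_iff_defPair.1 hV
    have hf' := definable_iff_defPair.1 hf.2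
    have hw' := definable_iff_defPair.1 w.2.2
    let Q : (Fin (m + 1) → K) → Prop := fun z => (fun i => z (Fin.castSucc i)) ∈ X.1 ∧
      (((fun i => z (Fin.castSucc i)) ∈ V ∧ ∃ a b,
        (Fin.snoc (fun i => z (Fin.castSucc i)) a : Fin (m + 1) → K) ∈ graph w.1 ∧
        (Fin.snoc (fun i => z (Fin.castSucc i)) b : Fin (m + 1) → K) ∈ graph f ∧
        a * b = z (Fin.last m)) ∨ (¬ (fun i => z (Fin.castSucc i)) ∈ V ∧ 0 = z (Fin.last m)))
    have hQ : DefPair L (id : K → K) (id : K → K) Q Q :=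
      .and (hX.relabel _) (.or (.and (hV.relabel _) (.ex (.ex
        (.and (hw'.snoc_mem (fun i => .var _) (.var _))
        (.and (hf'.snoc_mem (fun i => .var _) (.var _))
          (.eq (.mul (ι := ι) (.var _) (.var _)) (.var _)))))))
        (.and (.not (hV.relabel _)) (.eq (.zero (ι := ι)) (.var _))))
    have key : ∀ z, z ∈ graph (fun x : (X : Set (Fin m → K)) => w.1 x * F x.1) ↔ Q z := by
      intro z
      rw [mem_graph_iff]
      simp only [Q, snoc_mem_graph]
      constructor
      · rintro ⟨hx, hz⟩
        refine ⟨hx, ?_⟩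
        by_cases hxV : (fun i => z (Fin.castSucc i)) ∈ V
        · exact Or.inl ⟨hxV, _, _, ⟨hx, rfl⟩, ⟨hxV, rfl⟩, by rw [← hz, hF _ hxV]⟩
        · exact Or.inr ⟨hxV, by rw [← hz, hF0 _ hxV, mul_zero]⟩
      · rintro ⟨hx, ⟨hxV, _, _, ⟨_, rfl⟩, ⟨_, rfl⟩, hz⟩ | ⟨hxV, hz⟩⟩
        · exact ⟨hx, by rw [← hz, hF _ hxV]⟩
        · exact ⟨hx, by rw [← hz, hF0 _ hxV, mul_zero]⟩
    exact hQ.congr key key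
  · exact congrArg _ (hF _ hx)
  · change w.1 x * F x.1 = 0
    rw [hF0 _ hx, mul_zero]

end Extension

/-! ### Ring-theoretic description of limits of quotients -/

section RingPredicates

variable {R : Type*} [CommRing R] (B : Set R)

/-- `a` and `b` generate the unit ideal. -/
def Cop (a b : R) : Prop := ∃ u v, u * a + v * b = 1

/-- In rings of continuous definable functions: the zero set of `r` is a point. -/
def IsPt (r : R) : Prop := ¬ Cop r r ∧ ∀ a, ¬ Cop a r → ∀ b, Cop a b → Cop r b

/-- In rings of continuous definable functions: `|f| ≤ |g|` at the zero of `r`. -/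
def LEAt (r f g : R) : Prop := ∃ b ∈ B, ¬ Cop (f - g * b) r

/-- In rings of continuous definable functions: the value of `c` at the zero of `h` is a limit of
`g / h` on the zero set of `s`. -/
def IsLim (h s g c : R) : Prop :=
  ∀ η, Cop η h → ∃ r, IsPt r ∧ ¬ Cop s r ∧ ¬ LEAt B r (η * h) (g - c * h)

/-- In rings of continuous definable functions: every neighborhood of zero contains a power of `σ`.
-/
def IsArch (σ : R) : Prop :=
  ∃ h, IsPt h ∧ ∀ ε, Cop ε h → ∃ s g, IsLim B h s g 1 ∧
    (∀ c, IsLim B h s g c → LEAt B h c ε ∨ IsLim B h s g (σ * c)) ∧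
    ∀ c, ∃ η, Cop η h ∧ ∀ c', IsLim B h s g c' → ¬ Cop (c' - c) h ∨ LEAt B h η (c' - c)

end RingPredicates

/-! ### First-order definability of the ring predicates -/

section RingPredicatePairs

variable {M N : Type*} [CommRing M] [CommRing N]

/-- Each ring predicate is treated with arbitrary definable functions as arguments, so that the
predicates can be nested. The parameter type is empty: the formula is the same for all rings with a
predicate. -/
theorem defPair_isArch (B : Set M) (B' : Set N) :
    letI := ringBallStructure M B
    letI := ringBallStructure N B'
    DefPair ringBall (Empty.elim : Empty → M) (Empty.elim : Empty → N)
      (fun v : Unit → M => IsArch B (v ())) (fun v : Unit → N => IsArch B' (v ())) := by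
  let _ := ringBallStructure M B
  let _ := ringBallStructure N B'
  have add : ∀ {α : Type} {s t : (α → M) → M} {s' t' : (α → N) → N},
      FunPair ringBall (Empty.elim : Empty → M) (Empty.elim : Empty → N) s s' →
      FunPair ringBall Empty.elim Empty.elim t t' →
      FunPair ringBall (Empty.elim : Empty → M) (Empty.elim : Empty → N)
        (fun v => s v + t v) (fun v => s' v + t' v) := fun hs ht =>
    FunPair.comp₂ (F := fun x y => x + y) (F' := fun x y => x + y)
      (FunPair.funMap (L := ringBall) (n := 2) ringFunc.add) hs ht
  have mul : ∀ {α : Type} {s t : (α → M) → M} {s' t' : (α → N) → N},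
      FunPair ringBall (Empty.elim : Empty → M) (Empty.elim : Empty → N) s s' →
      FunPair ringBall Empty.elim Empty.elim t t' →
      FunPair ringBall (Empty.elim : Empty → M) (Empty.elim : Empty → N)
        (fun v => s v * t v) (fun v => s' v * t' v) := fun hs ht =>
    FunPair.comp₂ (F := fun x y => x * y) (F' := fun x y => x * y)
      (FunPair.funMap (L := ringBall) (n := 2) ringFunc.mul) hs ht
  have sub : ∀ {α : Type} {s t : (α → M) → M} {s' t' : (α → N) → N},
      FunPair ringBall (Empty.elim : Empty → M) (Empty.elim : Empty → N) s s' →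
      FunPair ringBall Empty.elim Empty.elim t t' →
      FunPair ringBall (Empty.elim : Empty → M) (Empty.elim : Empty → N)
        (fun v => s v - t v) (fun v => s' v - t' v) := fun {_ s t s' t'} hs ht => by
    simp only [sub_eq_add_neg]
    exact add hs ((FunPair.funMap (L := ringBall) (n := 1) ringFunc.neg).comp
      (t := fun _ => t) (t' := fun _ => t') fun _ => ht)
  have one : ∀ {α : Type}, FunPair ringBall (Empty.elim : Empty → M) (Empty.elim : Empty → N)
      (fun _ : α → M => 1) (fun _ : α → N => 1) := fun {α} =>
    (FunPair.funMap (L := ringBall) (n := 0) ringFunc.one).comp (α := α)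
      (t := fun i => i.elim0) (t' := fun i => i.elim0) fun i => i.elim0
  have mem : ∀ {α : Type} {s : (α → M) → M} {s' : (α → N) → N},
      FunPair ringBall (Empty.elim : Empty → M) (Empty.elim : Empty → N) s s' →
      DefPair ringBall (Empty.elim : Empty → M) (Empty.elim : Empty → N)
        (fun v => s v ∈ B) (fun v => s' v ∈ B') := fun {_ s s'} hs =>
    (DefPair.rel (L := ringBall) (n := 1) BallRel.ball).comp
      (t := fun _ => s) (t' := fun _ => s') fun _ => hs
  have cop : ∀ {α : Type} {s t : (α → M) → M} {s' t' : (α → N) → N},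
      FunPair ringBall (Empty.elim : Empty → M) (Empty.elim : Empty → N) s s' →
      FunPair ringBall Empty.elim Empty.elim t t' →
      DefPair ringBall (Empty.elim : Empty → M) (Empty.elim : Empty → N)
        (fun v => Cop (s v) (t v)) (fun v => Cop (s' v) (t' v)) := fun hs ht =>
    .ex (.ex (.eq (add (mul (.var _) ((hs.relabel _).relabel _))
      (mul (.var _) ((ht.relabel _).relabel _))) one))
  have pt : ∀ {α : Type} {s : (α → M) → M} {s' : (α → N) → N},
      FunPair ringBall (Empty.elim : Empty → M) (Empty.elim : Empty → N) s s' →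
      DefPair ringBall (Empty.elim : Empty → M) (Empty.elim : Empty → N)
        (fun v => IsPt (s v)) (fun v => IsPt (s' v)) := fun hs =>
    .and (.not (cop hs hs)) (.all (.imp (.not (cop (.var _) (hs.relabel _)))
      (.all (.imp (cop (.var _) (.var _)) (cop ((hs.relabel _).relabel _) (.var _))))))
  have le : ∀ {α : Type} {r s t : (α → M) → M} {r' s' t' : (α → N) → N},
      FunPair ringBall (Empty.elim : Empty → M) (Empty.elim : Empty → N) r r' →
      FunPair ringBall Empty.elim Empty.elim s s' →
      FunPair ringBall Empty.elim Empty.elim t t' →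
      DefPair ringBall (Empty.elim : Empty → M) (Empty.elim : Empty → N)
        (fun v => LEAt B (r v) (s v) (t v)) (fun v => LEAt B' (r' v) (s' v) (t' v)) :=
    fun hr hs ht =>
    .ex (.and (mem (.var _)) (.not (cop (sub (hs.relabel _) (mul (ht.relabel _) (.var _)))
      (hr.relabel _))))
  have lim : ∀ {α : Type} {h s g c : (α → M) → M} {h' s' g' c' : (α → N) → N},
      FunPair ringBall (Empty.elim : Empty → M) (Empty.elim : Empty → N) h h' →
      FunPair ringBall Empty.elim Empty.elim s s' →
      FunPair ringBall Empty.elim Empty.elim g g' →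
      FunPair ringBall Empty.elim Empty.elim c c' →
      DefPair ringBall (Empty.elim : Empty → M) (Empty.elim : Empty → N)
        (fun v => IsLim B (h v) (s v) (g v) (c v))
        (fun v => IsLim B' (h' v) (s' v) (g' v) (c' v)) :=
    fun hh hs hg hc =>
    .all (.imp (cop (.var _) (hh.relabel _)) (.ex (.and (pt (.var _))
      (.and (.not (cop ((hs.relabel _).relabel _) (.var _)))
        (.not (le (.var _) (mul (.var _) ((hh.relabel _).relabel _))
          (sub ((hg.relabel _).relabel _)
            (mul ((hc.relabel _).relabel _) ((hh.relabel _).relabel _)))))))))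
  exact .ex (.and (pt (.var _)) (.all (.imp (cop (.var _) (.var _)) (.ex (.ex (.and
    (lim (.var _) (.var _) (.var _) one) (.and
    (.all (.imp (lim (.var _) (.var _) (.var _) (.var _))
      (.or (le (.var _) (.var _) (.var _))
        (lim (.var _) (.var _) (.var _) (mul (.var _) (.var _))))))
    (.all (.ex (.and (cop (.var _) (.var _)) (.all (.imp (lim (.var _) (.var _) (.var _) (.var _))
      (.or (.not (cop (sub (.var _) (.var _)) (.var _)))
        (le (.var _) (.var _) (sub (.var _) (.var _))))))))))))))))

end RingPredicatePairs

/-! ### Geometric meaning of the ring predicates and the use of (BFin) -/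

section Geometry

variable {L : FirstOrder.Language.{u, v}} {ι : ringBall →ᴸ L}
  {K : Type w} [Field K] [L.Structure K] [IsFieldExpansion ι K] {m : ℕ}
  {X : L.DefinableSet (Set.univ : Set K) (Fin m)}

variable (ι X) in
/-- The set of functions in `𝒞(X)` with values in the unit ball. -/
def ballC : Set (C ι X) := {s | ∀ x, s.1 x ∈ unitBall ι K}

theorem cop_iff {f g : C ι X} : Cop f g ↔ ∀ x, ¬ (f.1 x = 0 ∧ g.1 x = 0) := by
  refine ⟨fun ⟨p, q, h⟩ x ⟨hf, hg⟩ => ?_, exists_mul_add_mul_eq_one f g⟩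
  have := congrFun (congrArg Subtype.val h) x
  change p.1 x * f.1 x + q.1 x * g.1 x = 1 at this
  simp [hf, hg] at this

/-- A function `r` with one zero acts as a name for this point, and comaximality with `r` tests
whether `f` is non-zero there. -/
theorem cop_iff_of_zero {r : C ι X} {q : (X : Set (Fin m → K))} (hr : ∀ x, r.1 x = 0 ↔ x = q)
    {f : C ι X} : Cop f r ↔ f.1 q ≠ 0 := by
  rw [cop_iff]
  refine ⟨fun h hf => h q ⟨hf, (hr q).2 rfl⟩, fun h x hx => h ?_⟩
  rw [← (hr x).1 hx.2]
  exact hx.1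

theorem isPt_iff {r : C ι X} : IsPt r ↔ ∃ q, ∀ x, r.1 x = 0 ↔ x = q := by
  constructor
  · rintro ⟨h1, h2⟩
    simp only [cop_iff, and_self, not_forall, not_not] at h1
    obtain ⟨q, hq⟩ := h1
    refine ⟨q, fun x => ⟨fun hx => ?_, fun hx => hx ▸ hq⟩⟩
    by_contra hne
    -- If `r` had two zeros `q` and `x`, functions `a`, `b` with zero sets `{q}` and `{x}` would
    -- violate the condition: `a` meets `r` and avoids `b`, but `r` and `b` share the zero `x`.
    obtain ⟨a, ha⟩ := exists_zero_iff_eq (ι := ι) q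
    obtain ⟨b, hb⟩ := exists_zero_iff_eq (ι := ι) x
    refine cop_iff.1 (h2 a ?_ b ?_) x ⟨hx, (hb x).2 rfl⟩
    · exact fun h => cop_iff.1 h q ⟨(ha q).2 rfl, hq⟩
    · rw [cop_iff_of_zero hb, ne_eq, ha]
      exact hne
  · rintro ⟨q, hq⟩
    refine ⟨fun h => (cop_iff_of_zero hq).1 h ((hq q).2 rfl), fun a ha b hb => ?_⟩
    rw [cop_iff_of_zero hq, not_not] at ha
    refine cop_iff.2 fun x hx => cop_iff.1 hb x ⟨?_, hx.2⟩
    rw [(hq x).1 hx.1, ha]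

theorem leAt_iff {r : C ι X} {q : (X : Set (Fin m → K))} (hr : ∀ x, r.1 x = 0 ↔ x = q)
    {f g : C ι X} : LEAt (ballC ι X) r f g ↔ AbsLE (unitBall ι K) (f.1 q) (g.1 q) := by
  simp only [LEAt, cop_iff_of_zero hr, not_not]
  constructor
  · rintro ⟨b, hb, h⟩
    exact ⟨b.1 q, hb q, sub_eq_zero.1 h⟩
  · rintro ⟨b, hb, h⟩
    exact ⟨constC X b, fun _ => hb, sub_eq_zero.2 h⟩

/-- The function `r` in the ring formula names the point `x`. The strict inequality forces `h x ≠
0`, so `x ≠ p`, and it says `|g/h - c| < |η|` at `x`. -/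
theorem isLim_iff {h : C ι X} {p : (X : Set (Fin m → K))} (hp : ∀ x, h.1 x = 0 ↔ x = p)
    {s g c : C ι X} : IsLim (ballC ι X) h s g c ↔ ∀ η : C ι X, η.1 p ≠ 0 → ∃ x, s.1 x = 0 ∧
      AbsLT (unitBall ι K) (g.1 x - c.1 x * h.1 x) (η.1 x * h.1 x) := by
  have hO := isUnitBall_unitBall ι K
  simp only [IsLim, cop_iff_of_zero hp]
  refine forall₂_congr fun η hη => ⟨?_, ?_⟩
  · rintro ⟨r, hr, h1, h2⟩
    obtain ⟨x, hx⟩ := isPt_iff.1 hr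
    rw [cop_iff_of_zero hx, not_not] at h1
    rw [leAt_iff hx, not_absLE hO] at h2
    exact ⟨x, h1, h2⟩
  · rintro ⟨x, h1, h2⟩
    obtain ⟨r, hr⟩ := exists_zero_iff_eq (ι := ι) x
    refine ⟨r, isPt_iff.2 ⟨x, hr⟩, ?_, ?_⟩
    · rwa [cop_iff_of_zero hr, not_not]
    · rw [leAt_iff hr, not_absLE hO]
      exact h2

/-- `IsLim` for constants, expressed by quantification over the field. -/
theorem isLim_constC_iff {h : C ι X} {p : (X : Set (Fin m → K))} (hp : ∀ x, h.1 x = 0 ↔ x = p)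
    {s g : C ι X} {γ : K} : IsLim (ballC ι X) h s g (constC X γ) ↔
      ∀ d : K, d ≠ 0 → ∀ r : K, r ≠ 0 → ∃ x : (X : Set (Fin m → K)),
        (∀ i, AbsLT (unitBall ι K) (x.1 i - p.1 i) r) ∧ s.1 x = 0 ∧
        AbsLT (unitBall ι K) (g.1 x - γ * h.1 x) (d * h.1 x) := by
  have hO := isUnitBall_unitBall ι K
  let _ := ballTopology (unitBall ι K)
  obtain ⟨e, he, he1⟩ := exists_ne_zero_absLT_one hO
  rw [isLim_iff hp]
  constructor
  · intro H d hd r hr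
    -- Testing with `η = d t` controls both the place and the error: `t x ≠ 0` puts `x` into the
    -- ball of radius `r`, and `|t| ≤ 1` bounds `|η|` by `|d|`.
    obtain ⟨t, ht1, ht2, ht3⟩ := exists_bump_ball (ι := ι) p (mul_ne_zero he hr)
    obtain ⟨x, hx1, hx2⟩ := H (constC X d * t) (by
      change d * t.1 p ≠ 0
      rwa [ht1, mul_one])
    change AbsLT _ (g.1 x - γ * h.1 x) (d * t.1 x * h.1 x) at hx2
    have htx : t.1 x ≠ 0 := right_ne_zero_of_mul (left_ne_zero_of_mul (hx2.ne_zero hO))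
    refine ⟨x, fun i => (ht3 x htx i).trans_absLT hO (absLT_mul_of_absLT_one hO he1 hr), hx1,
      hx2.trans_absLE hO (absLE_mul hO ?_ (absLE_refl hO _))⟩
    simpa using absLE_mul hO (absLE_refl hO d) (ht2 x)
  · intro H η hη
    -- Near `p` the function `η` dominates the non-zero constant `e * η p`, where `|e| < 1`; this
    -- constant serves as `d`.
    have hU : {x | AbsLT (unitBall ι K) (e * η.1 p) (η.1 x)} ∈ 𝓝 p := by
      have hc : Continuous fun x => (e * η.1 p, η.1 x) := continuous_const.prodMk η.2.1
      exact ((isOpen_absLT hO).preimage hc).mem_nhds (absLT_mul_of_absLT_one hO he1 hη)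
    obtain ⟨r, hr, hball⟩ := exists_ball_subset ι p hU
    obtain ⟨x, hx1, hx2, hx3⟩ := H (e * η.1 p) (mul_ne_zero he hη) r hr
    have := hball x hx1
    exact ⟨x, hx2, hx3.trans_absLE hO (absLE_mul hO this.1 (absLE_refl hO _))⟩

/-- (BFin) applies only to sets definable in the field structure. Therefore the quantifier over
`𝒞(X)` in the definition of limits has to be replaced by quantifiers over the field. -/
theorem definable_isLim_constC {h : C ι X} {p : (X : Set (Fin m → K))}
    (hp : ∀ x, h.1 x = 0 ↔ x = p) (s g : C ι X) :
    DefPair L (id : K → K) (id : K → K)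
      (fun v : Fin 1 → K => IsLim (ballC ι X) h s g (constC X (v 0)))
      (fun v : Fin 1 → K => IsLim (ballC ι X) h s g (constC X (v 0))) := by
  let Q : (Fin 1 → K) → Prop := fun v => ∀ d : K, d ≠ 0 → ∀ r : K, r ≠ 0 → ∃ x : Fin m → K,
    (∀ i, AbsLT (unitBall ι K) (x i - p.1 i) r) ∧ ∃ a b : K,
      (Fin.snoc (fun i => x i) 0 : Fin (m + 1) → K) ∈ graph s.1 ∧
      (Fin.snoc (fun i => x i) a : Fin (m + 1) → K) ∈ graph g.1 ∧
      (Fin.snoc (fun i => x i) b : Fin (m + 1) → K) ∈ graph h.1 ∧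
      AbsLT (unitBall ι K) (a - v 0 * b) (d * b)
  have hs := definable_iff_defPair.1 s.2.2
  have hg := definable_iff_defPair.1 g.2.2
  have hh := definable_iff_defPair.1 h.2.2
  have hQ : DefPair L (id : K → K) (id : K → K) Q Q :=
    .all (.imp (.not (.eq (.var _) (.zero (ι := ι)))) (.all (.imp
      (.not (.eq (.var _) (.zero (ι := ι)))) (.exists_fun (.and
      (.forall_finite fun i => .absLT (.sub (ι := ι) (.var _) (.const (p.1 i))) (.var _))
      (.ex (.ex (.and (hs.snoc_mem (fun i => .var _) (.zero (ι := ι)))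
        (.and (hg.snoc_mem (fun i => .var _) (.var _))
        (.and (hh.snoc_mem (fun i => .var _) (.var _))
          (.absLT (.sub (ι := ι) (.var _) (.mul (ι := ι) (.var _) (.var _)))
            (.mul (ι := ι) (.var _) (.var _)))))))))))))
  have key : ∀ v : Fin 1 → K, IsLim (ballC ι X) h s g (constC X (v 0)) ↔ Q v := by
    intro v
    rw [isLim_constC_iff hp]
    refine forall₂_congr fun d _ => forall₂_congr fun r _ => ⟨?_, ?_⟩
    · rintro ⟨x, h1, h2, h3⟩
      exact ⟨x.1, h1, _, _, (snoc_mem_graph_iff x).2 h2, (snoc_mem_graph_iff x).2 rfl,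
        (snoc_mem_graph_iff x).2 rfl, h3⟩
    · rintro ⟨x, h1, a, b, h2, h3, h4, h5⟩
      obtain ⟨hx, h2⟩ := snoc_mem_graph.1 h2
      obtain ⟨_, rfl⟩ := snoc_mem_graph.1 h3
      obtain ⟨_, rfl⟩ := snoc_mem_graph.1 h4
      exact ⟨⟨x, hx⟩, h1, h2, h5⟩
  exact hQ.congr key key

/-- If (BFin) holds, then `IsArch` implies that every neighborhood of zero contains a power
of `σ`. -/
theorem exists_absLE_of_isArch (hK : BFin ι K) {σ : K} (hσ : AbsLT (unitBall ι K) σ 1)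
    (h0 : σ ≠ 0) (harch : IsArch (ballC ι X) (constC X σ)) {x : K} (hx : x ≠ 0) :
    ∃ n : ℕ, AbsLE (unitBall ι K) (σ ^ n) x := by
  have hO := isUnitBall_unitBall ι K
  let _ := ballTopology (unitBall ι K)
  by_contra! hn
  obtain ⟨h, hpt, H⟩ := harch
  obtain ⟨p, hp⟩ := isPt_iff.1 hpt
  obtain ⟨s, g, h1, h2, h3⟩ := H (constC X x) ((cop_iff_of_zero hp).2 hx)
  -- As no power of `σ` is bounded by `|x|`, the closure property always yields the next power as a
  -- limit.
  have hpow : ∀ n : ℕ, IsLim (ballC ι X) h s g (constC X (σ ^ n)) := by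
    intro n
    induction n with
    | zero =>
      rw [pow_zero]
      exact h1
    | succ n ih =>
      rcases h2 _ ih with h | h
      · exact absurd ((leAt_iff hp).1 h) (hn n)
      · rw [pow_succ']
        exact h
  have hsep : ∀ γ : K, ∃ d : K, d ≠ 0 ∧ ∀ γ', IsLim (ballC ι X) h s g (constC X γ') →
      AbsLT (unitBall ι K) (γ' - γ) d → γ' = γ := by
    intro γ
    obtain ⟨η, hη, hγ⟩ := h3 (constC X γ)
    refine ⟨η.1 p, (cop_iff_of_zero hp).1 hη, fun γ' hγ' hlt => ?_⟩
    rcases hγ _ hγ' with h | h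
    · rw [cop_iff_of_zero hp, not_not] at h
      exact sub_eq_zero.1 h
    · exact absurd ((leAt_iff hp).1 h) hlt.2
  -- The intersection with the unit ball makes the set bounded and keeps all powers of `σ`; `hsep`
  -- makes it closed and discrete.
  let T : Set K := {γ | IsLim (ballC ι X) h s g (constC X γ) ∧ γ ∈ unitBall ι K}
  have hT : T.Finite := by
    refine hK T ?_ ?_ ⟨1, fun γ hγ => mem_iff_absLE_one.1 hγ.2⟩ ?_
    · exact definable_iff_defPair.2 ((definable_isLim_constC hp s g).and (.mem_unitBall (.var 0)))
    · refine ⟨isOpen_ballTopology fun γ hγ => ?_⟩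
      obtain ⟨d, hd, hγd⟩ := hsep γ
      refine ⟨d, hd, mem_openBall_self hO hd, fun γ' hγ' hT => hγ ?_⟩
      rw [← hγd γ' hT.1 hγ']
      exact hT
    · rw [isDiscrete_iff_forall_mem_exists_isOpen]
      intro γ hγ
      obtain ⟨d, hd, hγd⟩ := hsep γ
      refine ⟨_, isOpen_openBall (c := γ) hd, ?_⟩
      ext γ'
      refine ⟨fun h' => hγd γ' h'.2.1 h'.1, ?_⟩
      rintro rfl
      exact ⟨mem_openBall_self hO hd, hγ⟩
  refine (Set.infinite_of_injective_forall_mem (pow_injective_of_absLT hO hσ h0) fun n => ?_) hT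
  refine ⟨hpow n, mem_iff_absLE_one.2 ?_⟩
  simpa using absLE_pow_pow hO hσ.1 (Nat.zero_le n)

end Geometry

/-! ### Prescribing finite sets of limits by means of separated germs -/

section Germs

variable {L : FirstOrder.Language.{u, v}} {ι : ringBall →ᴸ L}
  {K : Type w} [Field K] [L.Structure K] [IsFieldExpansion ι K] {m : ℕ}
  {X : L.DefinableSet (Set.univ : Set K) (Fin m)}

/-- Given functions that vanish on separated germs at `p`, there are `h`, `s` and `g` such that the
limits of `g / h` at the zero `p` of `h`, taken on the zero set of `s`, are the elements of a given
finite family. -/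
theorem exists_isLim_iff {n : ℕ} (p : (X : Set (Fin m → K))) {U : Set (Fin m → K)}
    (hUX : U ⊆ X) (hU : (Set.univ : Set K).Definable L U)
    (hUp : letI := ballTopology (unitBall ι K); U ∈ 𝓝[(X : Set (Fin m → K))] p.1)
    (z : Fin (n + 2) → U → K) (hz : ∀ i, IsDefCont ι (z i))
    (hgerms : VanishOnSeparatedGerms ι p.1 z) (a : Fin (n + 2) → K)
    {h : C ι X} (hp : ∀ x, h.1 x = 0 ↔ x = p) :
    ∃ s g : C ι X, ∀ c : C ι X, IsLim (ballC ι X) h s g c ↔ ∃ i, c.1 p = a i := by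
  classical
  have hO := isUnitBall_unitBall ι K
  let _ := ballTopology (unitBall ι K)
  have _ := isTopologicalRing_ballTopology hO
  have _ := t1Space_ballTopology hO
  obtain ⟨δ, hδ, -, hvan, hsep, hbdd⟩ := hgerms
  have hUp' : {y : (X : Set (Fin m → K)) | y.1 ∈ U} ∈ 𝓝 p :=
    preimage_coe_mem_nhds_subtype.2 hUp
  -- The cutoff `t` carries functions from `U` to `X`. It makes `s = t ∏ z i` vanish outside `U` as
  -- well; the factor `t` of the test function used below discards these additional zeros.
  obtain ⟨t, ht1, ht2, F, hF, hFU, htF⟩ := exists_bump_nhds p hUp'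
  have htU : ∀ x, t.1 x ≠ 0 → x.1 ∈ U := fun x hx => by
    have := interior_subset (hFU (htF x hx))
    exact this
  have hnear : ∀ x, {y : (X : Set (Fin m → K)) | y.1 ∈ U} ∈ 𝓝 x ∨ ∀ᶠ y in 𝓝 x, t.1 y = 0 := by
    intro x
    by_cases hx : x ∈ F
    · exact Or.inl (mem_interior_iff_mem_nhds.1 (hFU hx))
    · right
      filter_upwards [hF.isOpen_compl.mem_nhds hx] with y hy
      by_contra hne
      exact hy (htF y hne)
  let U' : L.DefinableSet (Set.univ : Set K) (Fin m) := ⟨U, hU⟩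
  let z' : Fin (n + 2) → C ι U' := fun i => ⟨z i, hz i⟩
  obtain ⟨s, hs, hs0⟩ := exists_extend hU t (∏ i, z' i).1 (∏ i, z' i).2 fun x =>
    (hnear x).imp_right Or.inl
  have hs' : ∀ x (hx : x.1 ∈ U), s.1 x = t.1 x * ∏ i, z i ⟨x.1, hx⟩ := fun x hx => by
    rw [hs x hx]
    exact congrArg _ (prod_apply (X := U') Finset.univ z' ⟨x.1, hx⟩)
  have hV : (Set.univ : Set K).Definable L (U \ {p.1} : Set (Fin m → K)) := by
    have h1 := definable_iff_defPair.1 hU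
    have h2 : DefPair L (id : K → K) (id : K → K) (fun v : Fin m → K => ¬ ∀ i, v i = p.1 i)
        (fun v : Fin m → K => ¬ ∀ i, v i = p.1 i) :=
      .not (.forall_finite fun i => .eq (.var i) (.const (p.1 i)))
    refine definable_iff_defPair.2 ((h1.and h2).congr (fun v => ?_) (fun v => ?_)) <;>
    rw [← funext_iff] <;> rfl
  -- The function `δ i` need not extend continuously to `p`, but it is bounded and `h` vanishes at
  -- `p`, so `t h (δ i)` extends by zero.
  have hext := fun i => exists_extend hV (t * h) (δ i) (hδ i) fun x => by
    by_cases hx : x = p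
    · refine Or.inr (Or.inr ⟨?_, hbdd i⟩)
      change t.1 x * h.1 x = 0
      rw [(hp x).2 hx, mul_zero]
    · rcases hnear x with h1 | h1
      · left
        have h2 : {y : (X : Set (Fin m → K)) | y ≠ p} ∈ 𝓝 x := isOpen_ne.mem_nhds hx
        filter_upwards [h1, h2] with y hy1 hy2
        exact ⟨hy1, fun hy => hy2 (Subtype.ext hy)⟩
      · refine Or.inr (Or.inl ?_)
        filter_upwards [h1] with y hy
        change t.1 y * h.1 y = 0
        rw [hy, zero_mul]
  choose D hD _ using hext
  -- On the zeros of `z i` other than `p`, only the `i`-th summand survives and `g = a i * t * h`.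
  -- Hence `g / h` tends to `a i` along them.
  let g : C ι X := ∑ i, constC X (a i) * D i
  have hg : ∀ x (hx : x.1 ∈ U) i, x ≠ p → z i ⟨x.1, hx⟩ = 0 →
      g.1 x = a i * (t.1 x * h.1 x) := by
    intro x hx i hxp hzi
    have hxV : x.1 ∈ U \ {p.1} := ⟨hx, fun h' => hxp (Subtype.ext h')⟩
    have hxi : x.1 ∈ zeroSet (z i) \ {p.1} := ⟨⟨hx, hzi⟩, hxV.2⟩
    -- That `δ i` is `1` on its own germ is stated only relative to a second index; this is why
    -- there are `n + 2` functions.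
    obtain ⟨k, hk⟩ := exists_ne i
    rw [sum_apply, Finset.sum_eq_single i]
    · change a i * (D i).1 x = _
      rw [hD i x hxV, (hsep i k hk.symm).1 ⟨x.1, hxV⟩ hxi, mul_one]
      rfl
    · intro l _ hl
      change a l * (D l).1 x = 0
      rw [hD l x hxV, (hsep l i hl).2 ⟨x.1, hxV⟩ hxi, mul_zero, mul_zero]
    · exact fun h' => absurd (Finset.mem_univ i) h'
  let f : C ι X → Fin (n + 2) → C ι X := fun c i => t * constC X (a i) - c
  have hf : ∀ c i x, (f c i).1 x = t.1 x * a i - c.1 x := fun _ _ _ => rfl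
  have hfg : ∀ c x (hx : x.1 ∈ U) i, x ≠ p → z i ⟨x.1, hx⟩ = 0 →
      g.1 x - c.1 x * h.1 x = (f c i).1 x * h.1 x := by
    intro c x hx i hxp hzi
    rw [hg x hx i hxp hzi, hf]
    ring
  refine ⟨s, g, fun c => ?_⟩
  rw [isLim_iff hp]
  constructor
  · intro H
    by_contra! hne
    choose μ h1 h2 h3 using fun i => exists_absLE_one (f c i)
    -- If `c p` differs from every `a i`, the test function `t ∏ μ i` is non-zero at `p`. Its
    -- absolute value is at most `|t * a i - c|` for every `i`, contrary to the strict inequality at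
    -- a zero of some `z i`.
    obtain ⟨x, hsx, hx⟩ := H (t * ∏ i, μ i) (by
      change t.1 p * (∏ i, μ i).1 p ≠ 0
      rw [prod_apply, ht1, one_mul, Finset.prod_ne_zero_iff]
      intro i _
      rw [ne_eq, h1, hf, ht1, one_mul, sub_eq_zero]
      exact (hne i).symm)
    change AbsLT _ _ (t.1 x * (∏ i, μ i).1 x * h.1 x) at hx
    rw [prod_apply] at hx
    have hne0 := hx.ne_zero hO
    have hhx : h.1 x ≠ 0 := right_ne_zero_of_mul hne0
    have htx : t.1 x ≠ 0 := left_ne_zero_of_mul (left_ne_zero_of_mul hne0)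
    have hxU := htU x htx
    rw [hs' x hxU, mul_eq_zero, or_iff_right htx, Finset.prod_eq_zero_iff] at hsx
    obtain ⟨i, _, hzi⟩ := hsx
    rw [hfg c x hxU i (fun h' => hhx ((hp x).2 h')) hzi, absLT_mul_right_iff hO hhx] at hx
    refine hx.2 ?_
    have h4 : AbsLE (unitBall ι K) (∏ k, (μ k).1 x) ((f c i).1 x) := by
      rw [← Finset.mul_prod_erase _ _ (Finset.mem_univ i)]
      simpa using absLE_mul hO (h2 i x) (absLE_prod_one hO (Finset.univ.erase i)
        (fun k => (μ k).1 x) fun k _ => h3 k x)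
    simpa using absLE_mul hO (ht2 x) h4
  · rintro ⟨i, hi⟩ η hη
    have hW : {x | AbsLT (unitBall ι K) ((f c i).1 x) (η.1 x)} ∈ 𝓝 p := by
      have hc : Continuous fun x => ((f c i).1 x, η.1 x) := (f c i).2.1.prodMk η.2.1
      refine ((isOpen_absLT hO).preimage hc).mem_nhds ?_
      have h0 : (f c i).1 p = 0 := by rw [hf, ht1, hi, one_mul, sub_self]
      change AbsLT _ ((f c i).1 p) (η.1 p)
      rw [h0]
      exact absLT_zero_left hO hη
    obtain ⟨u, hu, huW⟩ := mem_nhds_subtype _ _ _ |>.1 hW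
    -- The zero `p` of `z i` is not isolated, so there is a zero `y ≠ p` so close to `p` that `|t *
    -- a i - c| < |η|` at `y`.
    obtain ⟨y, ⟨hyu, hyU, hy0⟩, hyp⟩ := accPt_iff_nhds.1 (hvan i).2 u hu
    let x : (X : Set (Fin m → K)) := ⟨y, hUX hyU⟩
    have hxp : x ≠ p := fun h' => hyp (congrArg Subtype.val h')
    refine ⟨x, ?_, ?_⟩
    · rw [hs' x hyU, Finset.prod_eq_zero (Finset.mem_univ i) hy0, mul_zero]
    · rw [hfg c x hyU i hxp hy0, absLT_mul_right_iff hO fun h' => hxp ((hp x).1 h')]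
      exact huW hyu

theorem isArch_of_germs {p₀ : Fin m → K}
    (hgerms : HasArbitrarilyManyGerms ι (X : Set (Fin m → K)) p₀) {σ : K}
    (hσ : AbsLT (unitBall ι K) σ 1)
    (harch : ∀ x : K, x ≠ 0 → ∃ n : ℕ, AbsLE (unitBall ι K) (σ ^ n) x) :
    IsArch (ballC ι X) (constC X σ) := by
  classical
  have hO := isUnitBall_unitBall ι K
  obtain ⟨hp₀, hgerms⟩ := hgerms
  let p : (X : Set (Fin m → K)) := ⟨p₀, hp₀⟩
  obtain ⟨h, hp⟩ := exists_zero_iff_eq (ι := ι) p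
  refine ⟨h, isPt_iff.2 ⟨p, hp⟩, fun ε hε => ?_⟩
  rw [cop_iff_of_zero hp] at hε
  obtain ⟨n, hn⟩ := harch _ hε
  obtain ⟨U, hUX, hU, hUp, z, hz, hzg⟩ := hgerms (n + 2) (by omega)
  -- The limits are `1, σ, …, σ^(n+1)`. Multiplication by `σ` leads to the next one except at the
  -- last, whose absolute value is at most `|σ^n| ≤ |ε p|`.
  obtain ⟨s, g, hlim⟩ := exists_isLim_iff p hUX hU hUp z hz hzg (fun i => σ ^ (i : ℕ)) hp
  refine ⟨s, g, (hlim 1).2 ⟨0, (pow_zero σ).symm⟩, fun c hc => ?_, fun c => ?_⟩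
  · obtain ⟨i, hi⟩ := (hlim c).1 hc
    by_cases hin : (i : ℕ) + 1 < n + 2
    · refine Or.inr ((hlim _).2 ⟨⟨i + 1, hin⟩, ?_⟩)
      change σ * c.1 p = σ ^ ((i : ℕ) + 1)
      rw [hi, pow_succ']
    · left
      rw [leAt_iff hp, hi]
      exact absLE_trans hO (absLE_pow_pow hO hσ.1 (by omega)) hn
  · obtain ⟨d, hd, hdr⟩ := exists_absLE_of_finite hO
      (r := fun i : Fin (n + 2) => if σ ^ (i : ℕ) = c.1 p then 1 else σ ^ (i : ℕ) - c.1 p)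
      fun i => by
        split_ifs with h
        · exact one_ne_zero
        · exact sub_ne_zero.2 h
    refine ⟨constC X d, (cop_iff_of_zero hp).2 hd, fun c' hc' => ?_⟩
    obtain ⟨i, hi⟩ := (hlim c').1 hc'
    have hsub : (c' - c).1 p = σ ^ (i : ℕ) - c.1 p := congrArg (· - c.1 p) hi
    rw [cop_iff_of_zero hp, leAt_iff hp, hsub, not_not]
    by_cases h : σ ^ (i : ℕ) = c.1 p
    · exact Or.inl (sub_eq_zero.2 h)
    · have := hdr i
      rw [if_neg h] at this
      exact Or.inr this

end Germs

/-! ### The natural embedding, by transfer -/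

section NaturalEmbedding

variable {L : FirstOrder.Language.{u, v}} {ι : ringBall →ᴸ L}
  {K : Type w} [L.Structure K] {K' : Type w'} [L.Structure K'] {m : ℕ}

/-- The basic form of transfer: after universal quantification the implication is a sentence with
parameters from `K`, that is, a predicate without free variables. -/
theorem DefPair.imp_of_elementary {α : Type*} [Finite α] {j : K ↪ₑ[L] K'} {P P₁ : (α → K) → Prop}
    {Q Q₁ : (α → K') → Prop} (h : DefPair L id j P Q) (h₁ : DefPair L id j P₁ Q₁) :
    (∀ v, Q v → Q₁ v) ↔ ∀ v, P v → P₁ v := by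
  have := DefPair.forall_fun (α := Empty) (β := α) (P := fun _ v => P v → P₁ v)
    (Q := fun _ v => Q v → Q₁ v) ((h.imp h₁).relabel Sum.inr)
  exact this.iff_of_elementary (j := j) Empty.elim

/-- The set defined in `K'` does not depend on the choice of the formula in `K`, which makes the
natural map well defined and unique. -/
theorem DefPair.right_unique {α : Type*} [Finite α] {j : K ↪ₑ[L] K'} {P : (α → K) → Prop}
    {Q Q₁ : (α → K') → Prop} (h : DefPair L id j P Q) (h₁ : DefPair L id j P Q₁) (v : α → K') :
    Q v ↔ Q₁ v :=
  ⟨(h.imp_of_elementary h₁).2 (fun _ => id) v, (h₁.imp_of_elementary h).2 (fun _ => id) v⟩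

theorem defPair_solutionSet {α : Type*} (j : K → K') (ψ : L.Formula (K ⊕ α)) :
    DefPair L id j (· ∈ solutionSet id ψ) (· ∈ solutionSet j ψ) :=
  ⟨ψ, fun _ => Iff.rfl, fun _ => Iff.rfl⟩

theorem exists_solutionSet_eq {α : Type*} {S : Set (α → K)}
    (hS : (Set.univ : Set K).Definable L S) : ∃ ψ : L.Formula (K ⊕ α), solutionSet id ψ = S := by
  obtain ⟨ψ, h, -⟩ := definable_iff_defPair.1 hS
  exact ⟨ψ, Set.ext h⟩

theorem graph_injective {X : Set (Fin m → K)} {f g : X → K} (h : graph f ⊆ graph g) : f = g := by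
  funext x
  have := h ((snoc_mem_graph_iff (f := f) x).2 rfl)
  exact ((snoc_mem_graph_iff x).1 this).symm

theorem mem_of_mem_graph {X : Set (Fin m → K)} {f : X → K} {x : Fin m → K} {y : K}
    (h : (Fin.snoc x y : Fin (m + 1) → K) ∈ graph f) : x ∈ X :=
  (snoc_mem_graph.1 h).1

variable [Field K] [Field K'] [IsFieldExpansion ι K] [IsFieldExpansion ι K']

variable (ι) in
/-- Continuity in terms of balls. -/
theorem continuous_iff_ball {S : Set (Fin m → K)} {f : S → K} :
    (letI := ballTopology (unitBall ι K); Continuous f) ↔ ∀ x : S, ∀ e : K, e ≠ 0 →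
      ∃ r : K, r ≠ 0 ∧ ∀ y : S, (∀ i, AbsLT (unitBall ι K) (y.1 i - x.1 i) r) →
        AbsLT (unitBall ι K) (f y - f x) e := by
  have hO := isUnitBall_unitBall ι K
  let _ := ballTopology (unitBall ι K)
  rw [continuous_iff_continuousAt]
  refine forall_congr' fun x => ⟨fun h e he => ?_, fun h s hs => ?_⟩
  · exact exists_ball_subset ι x (h (openBall_mem_nhds hO he))
  · obtain ⟨e, he, hes⟩ := exists_openBall_subset hO hs
    obtain ⟨r, hr, h⟩ := h e he
    change f ⁻¹' s ∈ 𝓝 x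
    exact Filter.mem_of_superset (ball_mem_nhds ι x hr) fun y hy => hes (h y hy)

variable {X : L.DefinableSet (Set.univ : Set K) (Fin m)}
  {X' : L.DefinableSet (Set.univ : Set K') (Fin m)} {j : K ↪ₑ[L] K'}

/-- Four properties of the graph are first-order and transfer: it lies over `X`, every point of `X`
has a value, the value is unique, and the function is continuous in the sense of balls. -/
theorem exists_defPair_graph (hX : DefPair L id j (· ∈ X.1) (· ∈ X'.1)) (f : C ι X) :
    ∃ f' : C ι X', DefPair L id j (· ∈ graph f.1) (· ∈ graph f'.1) := by
  obtain ⟨ψ, hψ⟩ := exists_solutionSet_eq f.2.2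
  have hG := defPair_solutionSet j ψ
  rw [hψ] at hG
  generalize solutionSet j ψ = G at hG
  have hdom : ∀ z, z ∈ G → (fun i => z (Fin.castSucc i)) ∈ X'.1 :=
    (hG.imp_of_elementary (hX.relabel Fin.castSucc)).2 fun z hz => hz.1
  have hex : ∀ x, x ∈ X'.1 → ∃ y, (Fin.snoc x y : Fin (m + 1) → K') ∈ G := by
    refine (hX.imp_of_elementary (.ex (P := fun x y => (Fin.snoc x y : Fin (m + 1) → K) ∈ graph f.1)
      (Q := fun x y => (Fin.snoc x y : Fin (m + 1) → K') ∈ G)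
      (hG.snoc_mem (fun i => .var _) (.var _)))).2 fun x hx => ?_
    exact ⟨_, (snoc_mem_graph_iff ⟨x, hx⟩).2 rfl⟩
  have huniq : ∀ x, x ∈ X'.1 → ∀ y y', (Fin.snoc x y : Fin (m + 1) → K') ∈ G →
      (Fin.snoc x y' : Fin (m + 1) → K') ∈ G → y = y' := by
    refine (hX.imp_of_elementary (.all (P := fun x y => ∀ y',
      (Fin.snoc x y : Fin (m + 1) → K) ∈ graph f.1 →
      (Fin.snoc x y' : Fin (m + 1) → K) ∈ graph f.1 → y = y')
      (Q := fun x y => ∀ y', (Fin.snoc x y : Fin (m + 1) → K') ∈ G →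
        (Fin.snoc x y' : Fin (m + 1) → K') ∈ G → y = y')
      (.all (.imp (hG.snoc_mem (fun i => .var _) (.var _)) (.imp
        (hG.snoc_mem (fun i => .var _) (.var _)) (.eq (.var _) (.var _))))))).2 fun x hx y y' h h' => ?_
    exact ((snoc_mem_graph_iff ⟨x, hx⟩).1 h).symm.trans ((snoc_mem_graph_iff ⟨x, hx⟩).1 h')
  have hcont : ∀ x, x ∈ X'.1 → ∀ y, (Fin.snoc x y : Fin (m + 1) → K') ∈ G → ∀ e : K', ¬ e = 0 →
      ∃ r : K', ¬ r = 0 ∧ ∀ x' : Fin m → K', (∀ i, AbsLT (unitBall ι K') (x' i - x i) r) →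
        ∀ y' : K', (Fin.snoc (fun i => x' i) y' : Fin (m + 1) → K') ∈ G →
          AbsLT (unitBall ι K') (y' - y) e := by
    refine (hX.imp_of_elementary (.all (P := fun x y =>
      (Fin.snoc x y : Fin (m + 1) → K) ∈ graph f.1 → ∀ e : K, ¬ e = 0 →
      ∃ r : K, ¬ r = 0 ∧ ∀ x' : Fin m → K, (∀ i, AbsLT (unitBall ι K) (x' i - x i) r) →
        ∀ y' : K, (Fin.snoc (fun i => x' i) y' : Fin (m + 1) → K) ∈ graph f.1 →
          AbsLT (unitBall ι K) (y' - y) e)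
      (Q := fun x y => (Fin.snoc x y : Fin (m + 1) → K') ∈ G → ∀ e : K', ¬ e = 0 →
      ∃ r : K', ¬ r = 0 ∧ ∀ x' : Fin m → K', (∀ i, AbsLT (unitBall ι K') (x' i - x i) r) →
        ∀ y' : K', (Fin.snoc (fun i => x' i) y' : Fin (m + 1) → K') ∈ G →
          AbsLT (unitBall ι K') (y' - y) e)
      (.imp (hG.snoc_mem (fun i => .var _) (.var _)) (.all (.imp
        (.not (.eq (.var _) (.zero (ι := ι)))) (.ex (.and (.not (.eq (.var _) (.zero (ι := ι))))
        (.forall_fun (.imp (.forall_finite fun i =>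
          .absLT (.sub (ι := ι) (.var _) (.var _)) (.var _))
          (.all (.imp (hG.snoc_mem (fun i => .var _) (.var _))
            (.absLT (.sub (ι := ι) (.var _) (.var _)) (.var _))))))))))))).2 ?_
    intro x hx y hy e he
    obtain ⟨r, hr, h⟩ := (continuous_iff_ball ι).1 f.2.1 ⟨x, hx⟩ e he
    refine ⟨r, hr, fun x' hx' y' hy' => ?_⟩
    rw [← (snoc_mem_graph_iff ⟨x, hx⟩).1 hy,
      ← (snoc_mem_graph_iff ⟨x', mem_of_mem_graph hy'⟩).1 hy']
    exact h _ hx'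
  choose F hF using hex
  let f' : ↥(X' : Set (Fin m → K')) → K' := fun x => F x.1 x.2
  have hgraph : ∀ z, z ∈ graph f' ↔ z ∈ G := by
    intro z
    have hz : (Fin.snoc (fun i => z (Fin.castSucc i)) (z (Fin.last m)) : Fin (m + 1) → K') = z :=
      Fin.snoc_init_self z
    rw [mem_graph_iff]
    constructor
    · rintro ⟨hx, hval⟩
      rw [← hz, ← hval]
      exact hF _ hx
    · intro hzG
      refine ⟨hdom z hzG, huniq _ (hdom z hzG) _ _ (hF _ _) ?_⟩
      rwa [hz]
  have hpair : DefPair L id j (· ∈ graph f.1) (· ∈ graph f') :=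
    hG.congr (fun _ => Iff.rfl) hgraph
  refine ⟨⟨f', (continuous_iff_ball ι).2 fun x e he => ?_, hpair.definable_right⟩, hpair⟩
  obtain ⟨r, hr, h⟩ := hcont x.1 x.2 _ (hF _ x.2) e he
  exact ⟨r, hr, fun y hy => h y.1 hy _ (hF _ y.2)⟩

/-- The natural map `𝒞(X) → 𝒞(X')`. -/
noncomputable def natMap (hX : DefPair L id j (· ∈ X.1) (· ∈ X'.1)) (f : C ι X) : C ι X' :=
  (exists_defPair_graph hX f).choose

variable (hX : DefPair L id j (· ∈ X.1) (· ∈ X'.1))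

theorem defPair_natMap (f : C ι X) :
    DefPair L id j (· ∈ graph f.1) (· ∈ graph (natMap hX f).1) :=
  (exists_defPair_graph hX f).choose_spec

theorem eq_natMap {f : C ι X} {f' : C ι X'}
    (h : DefPair L id j (· ∈ graph f.1) (· ∈ graph f'.1)) : f' = natMap hX f :=
  Subtype.ext (graph_injective fun z => (h.right_unique (defPair_natMap hX f) z).1)

theorem isNaturalMap_natMap : IsNaturalMap ι j (natMap (ι := ι) hX) := by
  intro f ψ hψ
  have h := defPair_solutionSet j ψ
  rw [hψ] at h
  exact Set.ext (h.right_unique (defPair_natMap hX f))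

theorem eq_natMap_of_isNaturalMap {e : C ι X → C ι X'} (he : IsNaturalMap ι j e) :
    e = natMap hX := by
  funext f
  obtain ⟨ψ, hψ⟩ := exists_solutionSet_eq f.2.2
  have h := defPair_solutionSet j ψ
  rw [hψ, he f ψ hψ] at h
  exact eq_natMap hX h

theorem natMap_constC (c : K) : natMap hX (constC (ι := ι) X c) = constC X' (j c) := by
  refine (eq_natMap hX ?_).symm
  have h := (hX.relabel Fin.castSucc).and ((FunPair.const c).eq (.var (Fin.last m)))
  refine h.congr (fun z => ?_) (fun z => ?_) <;>
  exact ⟨fun ⟨h1, h2⟩ => ⟨h1, h2⟩, fun ⟨h1, h2⟩ => ⟨h1, h2⟩⟩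

theorem natMap_injective : Function.Injective (natMap (ι := ι) hX) := by
  intro f g hfg
  have hf := defPair_natMap hX f
  rw [hfg] at hf
  exact Subtype.ext (graph_injective
    ((hf.imp_of_elementary (defPair_natMap hX g)).1 fun _ => id))

theorem ringOp_apply {n : ℕ} (F : ringFunc n) (f : Fin n → C ι X) (x : (X : Set (Fin m → K))) :
    (ringOp F f).1 x = ringOp F fun i => (f i).1 x := by
  cases F <;> rfl

/-- The operations are pointwise, so compatibility is a transferred statement about the values at
each point of the domain. -/
theorem natMap_ringOp {n : ℕ} (F : ringFunc n) (f : Fin n → C ι X) :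
    natMap hX (ringOp F f) = ringOp F fun i => natMap hX (f i) := by
  have h := (hX.imp_of_elementary (.all (P := fun x y => ∀ a : Fin n → K,
      (∀ i, (Fin.snoc x (a i) : Fin (m + 1) → K) ∈ graph (f i).1) →
      (Fin.snoc x y : Fin (m + 1) → K) ∈ graph (ringOp F f).1 → y = ringOp F fun i => a i)
    (Q := fun x y => ∀ a : Fin n → K',
      (∀ i, (Fin.snoc x (a i) : Fin (m + 1) → K') ∈ graph (natMap hX (f i)).1) →
      (Fin.snoc x y : Fin (m + 1) → K') ∈ graph (natMap hX (ringOp F f)).1 →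
      y = ringOp F fun i => a i)
    (.forall_fun (.imp (.forall_finite fun i => (defPair_natMap hX (f i)).snoc_mem
      (fun i => .var _) (.var _)) (.imp ((defPair_natMap hX _).snoc_mem (fun i => .var _) (.var _))
      (.eq (.var _) (.ringOp (ι := ι) F fun i => .var _))))))).2 fun x hx y a ha hy => by
        rw [← (snoc_mem_graph_iff ⟨x, hx⟩).1 hy, ringOp_apply]
        exact congrArg _ (funext fun i => (snoc_mem_graph_iff ⟨x, hx⟩).1 (ha i))
  refine Subtype.ext (funext fun x => ?_)
  rw [ringOp_apply]
  exact h x.1 x.2 _ _ (fun i => (snoc_mem_graph_iff x).2 rfl) ((snoc_mem_graph_iff x).2 rfl)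

theorem natMap_mem_ballC_iff (f : C ι X) : natMap hX f ∈ ballC ι X' ↔ f ∈ ballC ι X := by
  have h := hX.imp_of_elementary (.all (P := fun x y =>
      (Fin.snoc x y : Fin (m + 1) → K) ∈ graph f.1 → y ∈ unitBall ι K)
    (Q := fun x y => (Fin.snoc x y : Fin (m + 1) → K') ∈ graph (natMap hX f).1 → y ∈ unitBall ι K')
    (.imp ((defPair_natMap hX f).snoc_mem (fun i => .var _) (.var _)) (.mem_unitBall (.var _))))
  refine Iff.trans ⟨fun H x hx y hy => ?_, fun H x => ?_⟩
    (h.trans ⟨fun H x => ?_, fun H x hx y hy => ?_⟩)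
  · rw [← (snoc_mem_graph_iff ⟨x, hx⟩).1 hy]
    exact H _
  · exact H x.1 x.2 _ ((snoc_mem_graph_iff x).2 rfl)
  · exact H x.1 x.2 _ ((snoc_mem_graph_iff x).2 rfl)
  · rw [← (snoc_mem_graph_iff ⟨x, hx⟩).1 hy]
    exact H _

/-- The natural map `𝒞(X) → 𝒞(X')`, as an embedding of `ringBall`-structures. -/
noncomputable def natEmbedding : C ι X ↪[ringBall] C ι X' where
  toFun := natMap hX
  inj' := natMap_injective hX
  map_fun' := fun F f => natMap_ringOp hX F f
  map_rel' := fun {_} r f => match r, f with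
    | .ball, f => natMap_mem_ballC_iff hX (f 0)

end NaturalEmbedding

/-! ### Transfer of `IsArch` and of powers of `τ` -/

section NotElementary

/-- When `|σ| ≤ 1`, replacing a negative exponent by `0` does not increase the absolute value, so
natural exponents suffice. -/
theorem absLE_toNat_zpow {K : Type*} [Field K] {O : Set K} (hO : IsUnitBall O) {σ : K}
    (hσ : AbsLE O σ 1) (h0 : σ ≠ 0) (k : ℤ) : AbsLE O (σ ^ k.toNat) (σ ^ k) := by
  obtain ⟨Γ, _, φ, hφ⟩ := hO.exists_monoidWithZeroHom
  rw [hφ, map_one] at hσ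
  rw [hφ, map_pow, map_zpow₀, ← zpow_natCast]
  have h0' : 0 < φ σ := zero_lt_iff.2 ((map_ne_zero φ).2 h0)
  exact zpow_le_zpow_right_of_le_one₀ h0' hσ (Int.self_le_toNat k)

variable {L : FirstOrder.Language.{u, v}} {ι : ringBall →ᴸ L}
  {K : Type w} [Field K] [L.Structure K] [IsFieldExpansion ι K]
  {K' : Type w'} [Field K'] [L.Structure K'] [IsFieldExpansion ι K'] {m : ℕ}
  {X : L.DefinableSet (Set.univ : Set K) (Fin m)}
  {X' : L.DefinableSet (Set.univ : Set K') (Fin m)}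

theorem isArch_iff_of_elementary (g : C ι X ↪ₑ[ringBall] C ι X') (f : C ι X) :
    IsArch (ballC ι X') (g f) ↔ IsArch (ballC ι X) f := by
  have h := defPair_isArch (ballC ι X) (ballC ι X')
  rw [show (Empty.elim : Empty → C ι X') = fun x => g (Empty.elim x) from
    funext fun x => x.elim] at h
  exact h.iff_of_elementary (fun _ => f)

theorem absLT_iff_of_elementary (j : K ↪ₑ[L] K') (x y : K) :
    AbsLT (unitBall ι K') (j x) (j y) ↔ AbsLT (unitBall ι K) x y := by
  have h : DefPair L id j (fun v : Fin 2 → K => AbsLT (unitBall ι K) (v 0) (v 1))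
    (fun v : Fin 2 → K' => AbsLT (unitBall ι K') (v 0) (v 1)) := .absLT (.var 0) (.var 1)
  exact h.iff_of_elementary ![x, y]

theorem map_ringOp_of_elementary (ι : ringBall →ᴸ L) [IsFieldExpansion ι K]
    [IsFieldExpansion ι K'] (j : K ↪ₑ[L] K') {n : ℕ} (F : ringFunc n) (x : Fin n → K) :
    j (ringOp F x) = ringOp F fun i => j (x i) := by
  rw [← IsFieldExpansion.funMap_eq (ι := ι), j.map_fun, IsFieldExpansion.funMap_eq]
  rfl

theorem map_inv_of_elementary (ι : ringBall →ᴸ L) [IsFieldExpansion ι K]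
    [IsFieldExpansion ι K'] (j : K ↪ₑ[L] K') (x : K) : j x⁻¹ = (j x)⁻¹ := by
  have h0 : j 0 = 0 := map_ringOp_of_elementary ι j .zero ![]
  have h1 : j 1 = 1 := map_ringOp_of_elementary ι j .one ![]
  by_cases hx : x = 0
  · rw [hx, inv_zero, h0, inv_zero]
  · have h := map_ringOp_of_elementary ι j .mul ![x, x⁻¹]
    change j (x * x⁻¹) = j x * j x⁻¹ at h
    rw [mul_inv_cancel₀ hx, h1] at h
    exact eq_inv_of_mul_eq_one_right h.symm

end NotElementary

end DefCont

/-! ### The corollary -/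

open DefCont in
theorem corollary5p6 {L : FirstOrder.Language.{u, v}} (ι : DefCont.ringBall →ᴸ L)
    {K : Type w} [Field K] [L.Structure K] [DefCont.IsFieldExpansion ι K]
    {K' : Type w'} [Field K'] [L.Structure K'] [DefCont.IsFieldExpansion ι K']
    (j : K ↪ₑ[L] K')
    (hK : DefCont.BFin ι K) (hK' : DefCont.BFin ι K')
    {m : ℕ} (X : L.DefinableSet (Set.univ : Set K) (Fin m)) (p₀ : Fin m → K)
    (hgerms : DefCont.HasArbitrarilyManyGerms ι (X : Set (Fin m → K)) p₀)
    (X' : L.DefinableSet (Set.univ : Set K') (Fin m))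
    (hX' : ∃ φ : L.Formula (K ⊕ Fin m),
      (X : Set (Fin m → K)) = DefCont.solutionSet id φ ∧
      (X' : Set (Fin m → K')) = DefCont.solutionSet j φ)
    (τ : K) (hτ : DefCont.TauArchimedean (DefCont.unitBall ι K) τ)
    (hτ' : ¬ DefCont.TauArchimedean (DefCont.unitBall ι K') (j τ)) :
    ∃ e : DefCont.C ι X ↪[DefCont.ringBall] DefCont.C ι X',
      DefCont.IsNaturalMap ι j e ∧
      (∀ e' : DefCont.C ι X → DefCont.C ι X', DefCont.IsNaturalMap ι j e' → e' = e) ∧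
      ¬ ∃ g : DefCont.C ι X ↪ₑ[DefCont.ringBall] DefCont.C ι X', (g : _ → _) = e := by
  obtain ⟨φ, hφ, hφ'⟩ := hX'
  have hX : DefPair L id j (· ∈ X.1) (· ∈ X'.1) := by
    have h := defPair_solutionSet j φ
    rw [← hφ, ← hφ'] at h
    exact h
  refine ⟨natEmbedding hX, isNaturalMap_natMap hX, fun e' => eq_natMap_of_isNaturalMap hX, ?_⟩
  rintro ⟨g, hg⟩
  have hO := isUnitBall_unitBall ι K
  have hO' := isUnitBall_unitBall ι K'
  -- If `j τ` were zero, its first power would lie below every element, and `|K'^×|` would be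
  -- archimedean for it.
  have hτ0 : j τ ≠ 0 := by
    intro h0
    refine hτ' fun x _ => ⟨1, ?_⟩
    rw [h0, zpow_one]
    exact absLE_zero hO' x
  have hj0 : j 0 = 0 := map_ringOp_of_elementary ι j .zero ![]
  have hj1 : j 1 = 1 := map_ringOp_of_elementary ι j .one ![]
  have hτ0' : τ ≠ 0 := by
    rintro rfl
    exact hτ0 hj0
  -- The exponent `ε` is `1` or `-1`, chosen so that `|σ| < 1`; integer powers of `τ` and of `σ` are
  -- then the same elements.
  obtain ⟨σ, ε, hσ, hσ1⟩ : ∃ σ : K, ∃ ε : ℤ, (σ = τ ^ ε ∧ τ = σ ^ ε ∧ j σ = j τ ^ ε) ∧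
      AbsLT (unitBall ι K) σ 1 := by
    rcases hτ.exists_absLT_one hO with h | h
    · exact ⟨τ, 1, by simp, h⟩
    · exact ⟨τ⁻¹, -1, by simp [map_inv_of_elementary ι], h⟩
  obtain ⟨hσ, hτσ, hjσ⟩ := hσ
  have hσ0 : σ ≠ 0 := hσ ▸ zpow_ne_zero ε hτ0'
  have harch : IsArch (ballC ι X) (constC X σ) := by
    refine isArch_of_germs hgerms hσ1 fun x hx => ?_
    obtain ⟨k, hk⟩ := hτ x hx
    rw [hτσ, ← zpow_mul] at hk
    exact ⟨_, absLE_trans hO (absLE_toNat_zpow hO hσ1.1 hσ0 _) hk⟩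
  have harch' : IsArch (ballC ι X') (constC X' (j σ)) := by
    -- An elementary `g` equal to the natural map sends the constant `σ` to the constant `j σ`,
    -- hence carries `IsArch` over to `𝒞(X')`.
    rw [← natMap_constC hX, ← show g _ = natMap hX _ from congrFun hg (constC X σ)]
    exact (isArch_iff_of_elementary g _).2 harch
  refine hτ' fun x hx => ?_
  have hjσ1 : AbsLT (unitBall ι K') (j σ) 1 := by
    rw [← hj1]
    exact (absLT_iff_of_elementary j σ 1).2 hσ1
  obtain ⟨n, hn⟩ := exists_absLE_of_isArch hK' hjσ1 (hjσ ▸ zpow_ne_zero ε hτ0) harch' hx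
  refine ⟨ε * n, ?_⟩
  rwa [zpow_mul, ← hjσ, zpow_natCast]
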